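/- **Setting.** Agents $i=1,\dots,n$ and variables $x_1,\dots,x_m$, $x_v\in\mathbb R^{d_v}$. Agent $i$ is concerned with the block $\mathcal X_i$ of variables $x_v$, $v\in S_i$, where $\bigcup_i S_i=\{1,\dots,m\}$; $\mathcal X_{ij}$ is the block of variables in $S_i\cap S_j$, and $\mathcal X$ the block of all variables. Agent $i$ has a known measurable likelihood $q_i(z\mid\mathcal X_i)$, for every $\mathcal X_i$ a probability density in $z$ on a measurable set $Z_i\subseteq\mathbb R^{\ell_i}$ of possible measurements. Put $q(z\mid\mathcal X)=\prod_i q_i(z_i\mid\mathcal X_i)$, let $\mathcal X^\star$ be the true parameter, $q^\star=q(\cdot\mid\mathcal X^\star)$, and let $\mathcal F^\star$ be the set of probability densities $p$ of $\mathcal X$ (with respect to Lebesgue measure) that minimize $f[p]=\mathbb E_{z\sim q^\star}\,\mathbb E_{\mathcal X\sim p}[-\log q(z\mid\mathcal X)]$. **Assumptions.** 1. The measurements $z_{i,t}$ ($t\ge 0$) are independent across agents and times, and $z_{i,t}$ has density $q_i(\cdot\mid\mathcal X_i^\star)$ on $Z_i$. 2. The agents communicate over a connected graph $\mathcal G$ with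 a symmetric doubly stochastic matrix $A\ge 0$ such that $A_{ij}>0$ if and only if $i=j$ or $ij$ is an edge. 3. For some $L$: $q_i(z\mid\mathcal X_i)>0$ and $|\log q_i(z\mid\mathcal X_i)|\le L$ for all $i$, $z\in Z_i$ and $\mathcal X_i$. 4. The step sizes satisfy $\alpha_t>0$, $\sum_t\alpha_t=\infty$, $\sum_t\alpha_t^2<\infty$. 5. The (deterministic) prior densities $p_{i,0}$ of $\mathcal X_i$ are everywhere positive. 6. For every variable $x_v$, the agents $i$ with $v\in S_i$ induce a connected subgraph of $\mathcal G$. **Algorithm (DMSMD).** Given densities $p_{i,t}$ of $\mathcal X_i$, let $p_{ji,t}(\mathcal X_{ij})$ be the marginal of $p_{j,t}$ over $\mathcal X_{ij}$ and put $$\tilde p_{ji,t}=p_{i,t}(\mathcal X_i\setminus\mathcal X_{ij}\mid\mathcal X_{ij})\,p_{ji,t}(\mathcal X_{ij}),\qquad v_{i,t}=\frac1{Z^v_{i,t}}\prod_{j:A_{ij}>0}\tilde p_{ji,t}^{\,A_{ij}},\qquad Z^v_{i,t}=\int\prod_{j:A_{ij}>0}\tilde p_{ji,t}^{\,A_{ij}}\,d\mathcal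 X_i,$$ $$p_{i,t+1}\in\arg\min_{p}\Big\{\alpha_t\big\langle-\log q_i(z_{i,t}\mid\cdot),p\big\rangle+\mathrm{KL}[p,v_{i,t}]\Big\},$$ the minimum being over all probability densities $p$ of $\mathcal X_i$. **Conjecture 1 (assumed).** There are constants $\sigma\in(0,1)$ and $c>1$ such that, almost surely, there are joint densities $\bar p_t$ of $\mathcal X$, $t\ge 0$, with marginals $\bar p_{i,t}$ over $\mathcal X_i$, such that for all $t$ and $i$ $$\|v_{i,t}-\bar p_{i,t}\|_{TV}\le\sigma\,\|p_{i,t}-\bar p_{i,t}\|_{TV},\qquad \|\bar p_t-\bar p_{t+1}\|_{TV}\le (c-1)\,\alpha_t L/2 .$$ **Theorem.** Under Assumptions 1–6 and Conjecture 1, let $p^\star\in\mathcal F^\star$ have marginals $p_i^\star$ over $\mathcal X_i$, with $\mathrm{KL}[p_i^\star,p_{i,0}]<\infty$ for all $i$. Then, almost surely, $\sum_{i=1}^n\mathrm{KL}[p_i^\star,v_{i,t}]$ converges to a finite value as $t\to\infty$. -/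

import Mathlib

open MeasureTheory ProbabilityTheory Filter Topology
open scoped ENNReal NNReal

noncomputable section

/-! ### Blocks of variables, probability densities, divergences -/

/-- Joint values of the variables `x_v ∈ ℝ^{d v}` with `v` in the finite set `S`, with the product
Lebesgue measure as volume. -/
abbrev VarSpace {m : ℕ} (d : Fin m → ℕ) (S : Finset (Fin m)) : Type :=
  ∀ v : S, EuclideanSpace ℝ (Fin (d v))

/-- Forget the variables outside of `S`. -/
def restrictVars {m : ℕ} {d : Fin m → ℕ} {S T : Finset (Fin m)} (h : S ⊆ T)
    (x : VarSpace d T) : VarSpace d S :=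
  fun v => x ⟨v.1, h v.2⟩

/-- The point with `S`-coordinates `x` and remaining coordinates `y`. -/
def glueVars {m : ℕ} {d : Fin m → ℕ} {S T : Finset (Fin m)}
    (x : VarSpace d S) (y : VarSpace d (T \ S)) : VarSpace d T :=
  fun v => if h : v.1 ∈ S then x ⟨v.1, h⟩ else y ⟨v.1, Finset.mem_sdiff.2 ⟨v.2, h⟩⟩

/-- The marginal over the variables in `S` of a density `p` in the variables `T ⊇ S`:
the variables in `T \ S` are integrated out. -/
def marginal {m : ℕ} {d : Fin m → ℕ} {T : Finset (Fin m)} (S : Finset (Fin m))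
    (p : VarSpace d T → ℝ) : VarSpace d S → ℝ :=
  fun x => ∫ y : VarSpace d (T \ S), p (glueVars x y)

/-- Probability density functions with respect to the volume. -/
structure IsPDF {X : Type*} [MeasureSpace X] (p : X → ℝ) : Prop where
  measurable : Measurable p
  nonneg : ∀ x, 0 ≤ p x
  integrable : Integrable p
  integral_eq_one : ∫ x, p x = 1

/-- The Kullback-Leibler divergence `KL[p, g] = ∫ p log (p / g)`, a value in `[0, ∞]`. -/
def kl {X : Type*} [MeasureSpace X] (p g : X → ℝ) : ℝ≥0∞ :=
  InformationTheory.klDiv (volume.withDensity fun x => ENNReal.ofReal (p x))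
    (volume.withDensity fun x => ENNReal.ofReal (g x))

/-- The total variation distance `sup_B |p(B) - g(B)|` over measurable sets `B`. -/
def tvDist {X : Type*} [MeasureSpace X] (p g : X → ℝ) : ℝ :=
  ⨆ B : {B : Set X // MeasurableSet B}, |(∫ x in B.1, p x) - ∫ x in B.1, g x|

/-! ### The communication network -/

/-- `A` is a symmetric, doubly stochastic adjacency matrix of the connected graph `G` in which
every node carries a self-loop. (Columns sum to one by symmetry.) -/
structure IsGraphAdjacency {n : ℕ} (G : SimpleGraph (Fin n)) (A : Matrix (Fin n) (Fin n) ℝ) :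
    Prop where
  connected : G.Connected
  nonneg : ∀ i j, 0 ≤ A i j
  pos_iff : ∀ i j, 0 < A i j ↔ i = j ∨ G.Adj i j
  symm : A.transpose = A
  row_sum : ∀ i, ∑ j, A i j = 1

/-! ### Likelihoods and the estimation objective -/

/-- `q z x = q(z | x)` is a likelihood model: for every `x` a probability density of the
measurement `z` on the measurement set `Z`. -/
structure IsLikelihood {E X : Type*} [MeasureSpace E] [MeasurableSpace X] (Z : Set E)
    (q : E → X → ℝ) : Prop where
  measurable : Measurable (Function.uncurry q)
  nonneg : ∀ z x, 0 ≤ q z x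
  integrable : ∀ x, IntegrableOn (fun z => q z x) Z
  integral_eq_one : ∀ x, ∫ z in Z, q z x = 1

/-- The law of a measurement with density `q(· | x)` on `Z`. -/
def measurementLaw {E X : Type*} [MeasureSpace E] (Z : Set E) (q : E → X → ℝ) (x : X) :
    Measure E :=
  (volume.restrict Z).withDensity fun z => ENNReal.ofReal (q z x)

/-- The likelihood `∏ i, q_i(z_i | X_i)` of the measurements of all agents. -/
def jointLikelihood {n m : ℕ} {d : Fin m → ℕ} {ℓ : Fin n → ℕ} {S : Fin n → Finset (Fin m)}
    (q : ∀ i, EuclideanSpace ℝ (Fin (ℓ i)) → VarSpace d (S i) → ℝ)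
    (z : ∀ i, EuclideanSpace ℝ (Fin (ℓ i))) (x : VarSpace d Finset.univ) : ℝ :=
  ∏ i, q i (z i) (restrictVars (Finset.subset_univ (S i)) x)

/-- The objective `f[p] = E_{z ∼ q(· | X⋆)} E_{X ∼ p} [-log q(z | X)]`. -/
def objective {n m : ℕ} {d : Fin m → ℕ} {ℓ : Fin n → ℕ} {S : Fin n → Finset (Fin m)}
    (Z : ∀ i, Set (EuclideanSpace ℝ (Fin (ℓ i))))
    (q : ∀ i, EuclideanSpace ℝ (Fin (ℓ i)) → VarSpace d (S i) → ℝ)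
    (xstar : VarSpace d Finset.univ) (p : VarSpace d Finset.univ → ℝ) : ℝ :=
  ∫ z, (∫ x, -Real.log (jointLikelihood q z x) * p x)
    ∂(Measure.pi fun i =>
        measurementLaw (Z i) (q i) (restrictVars (Finset.subset_univ (S i)) xstar))

/-- The set of the joint densities that minimize the objective. -/
def optimalPDFs {n m : ℕ} {d : Fin m → ℕ} {ℓ : Fin n → ℕ} {S : Fin n → Finset (Fin m)}
    (Z : ∀ i, Set (EuclideanSpace ℝ (Fin (ℓ i))))
    (q : ∀ i, EuclideanSpace ℝ (Fin (ℓ i)) → VarSpace d (S i) → ℝ)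
    (xstar : VarSpace d Finset.univ) : Set (VarSpace d Finset.univ → ℝ) :=
  {p | IsPDF p ∧ ∀ p', IsPDF p' → objective Z q xstar p ≤ objective Z q xstar p'}

/-! ### The distributed marginal stochastic mirror descent algorithm -/

/-- Edge merging: agent `i`'s conditional density of its other variables given the variables
shared with `j`, times agent `j`'s marginal over the shared variables. -/
def edgeMerge {n m : ℕ} {d : Fin m → ℕ} {S : Fin n → Finset (Fin m)}
    (p : ∀ i, VarSpace d (S i) → ℝ) (i j : Fin n) (x : VarSpace d (S i)) : ℝ :=
  p i x / marginal (S i ∩ S j) (p i) (restrictVars Finset.inter_subset_left x) *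
    marginal (S i ∩ S j) (p j) (restrictVars Finset.inter_subset_left x)

/-- Geometric pooling: the normalized weighted geometric average `v_i` of the merged densities.
Agents `j` that are not neighbors of `i` have `A i j = 0` and contribute the factor `1`. -/
def mixed {n m : ℕ} {d : Fin m → ℕ} {S : Fin n → Finset (Fin m)}
    (A : Matrix (Fin n) (Fin n) ℝ) (p : ∀ i, VarSpace d (S i) → ℝ) (i : Fin n) :
    VarSpace d (S i) → ℝ :=
  fun x => (∏ j, edgeMerge p i j x ^ A i j) / ∫ y, ∏ j, edgeMerge p i j y ^ A i j

/-- The mirror descent objective `J[p, v] = α ⟨-log q(z | ·), p⟩ + KL[p, v]`. -/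
def mirrorObjective {E X : Type*} [MeasureSpace X] (q : E → X → ℝ) (a : ℝ) (z : E)
    (p v : X → ℝ) : EReal :=
  ((a * ∫ x, -Real.log (q z x) * p x : ℝ) : EReal) + ((kl p v : ℝ≥0∞) : EReal)

/-- `p t i` are the iterates of the algorithm with steps `α`, measurements `z t i`, and
priors `p₀ i`: each `p (t + 1) i` minimizes the mirror descent objective with the mixed density
`v_{i,t}` among all densities. -/
def IsDMSMDRun {n m : ℕ} {d : Fin m → ℕ} {ℓ : Fin n → ℕ} {S : Fin n → Finset (Fin m)}
    (A : Matrix (Fin n) (Fin n) ℝ)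
    (q : ∀ i, EuclideanSpace ℝ (Fin (ℓ i)) → VarSpace d (S i) → ℝ) (α : ℕ → ℝ)
    (p₀ : ∀ i, VarSpace d (S i) → ℝ) (z : ℕ → ∀ i, EuclideanSpace ℝ (Fin (ℓ i)))
    (p : ℕ → ∀ i, VarSpace d (S i) → ℝ) : Prop :=
  p 0 = p₀ ∧ ∀ t i, IsPDF (p (t + 1) i) ∧
    ∀ p', IsPDF p' →
      mirrorObjective (q i) (α t) (z t i) (p (t + 1) i) (mixed A (p t) i) ≤
        mirrorObjective (q i) (α t) (z t i) p' (mixed A (p t) i)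

/-- The conjectured contraction property of the iterates `p t i`, with constants `σ` and `c`:
there are joint densities `pbar t` toward whose marginals one mixing step contracts with factor
`σ` in total variation, and which move by at most `(c - 1) α_t L / 2` per step. -/
def MarginalContraction {n m : ℕ} {d : Fin m → ℕ} {S : Fin n → Finset (Fin m)}
    (A : Matrix (Fin n) (Fin n) ℝ) (α : ℕ → ℝ) (L σ c : ℝ)
    (p : ℕ → ∀ i, VarSpace d (S i) → ℝ) : Prop :=
  ∃ pbar : ℕ → VarSpace d Finset.univ → ℝ, ∀ t, IsPDF (pbar t) ∧
    (∀ i, tvDist (mixed A (p t) i) (marginal (S i) (pbar t)) ≤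
      σ * tvDist (p t i) (marginal (S i) (pbar t))) ∧
    tvDist (pbar t) (pbar (t + 1)) ≤ (c - 1) * α t * L / 2

end

/-!
The total divergence `V t = ∑ i, KL[p⋆_i, v_{i,t}]` is almost a supermartingale.

*Mixing.* A geometric pool of subprobability densities has normalizing constant at most one, by the
inequality of the arithmetic and geometric means, so pooling does not increase the average
divergence (`geometric_pooling_spec`). Edge merging changes `KL[p⋆_i, p_i]` by a difference of
divergences of marginals over the shared variables (`marginal_replacement_spec`), and these
differences cancel in the sum over all edges because `A` is symmetric (`mixed_spec`). Finiteness of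
the divergences, inherited by marginals from the data processing inequality, is also what keeps the
normalizing constants positive.

*Mirror step.* The minimizer of the mirror descent objective is the exponential tilt of `v_{i,t}`
by `α_t log q_i(z_{i,t} | ·)`, uniquely up to null sets (`ae_eq_expTilt_of_forall_le`). Hoeffding's
lemma (`log_integral_exp_mul_le`) then gives
`V (t + 1) ≤ V t + α_t ∑ i, ⟨log q_i(z_{i,t} | ·), v_{i,t} - p⋆_i⟩ + O(α_t²)`.

*Noise.* The inner product is split into its mean given the past and a centered rest. The rests,
weighted by `α_t`, are increments of a martingale bounded in `L²`, so that their series converges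
(`ae_exists_tendsto_sum_of_centered`). This needs joint measurability of the iterates in the
measurements and the variables. It is not assumed of the given run, but it holds for the closed form
`dmsmdIterates`, which agrees with the run up to null sets.

*Drift.* The objective is a sum of linear functionals of the marginals (`objective_eq`). Optimality
of `p⋆` against the consensus density bounds the sum of the conditional means by `L` times the `L¹`
distance of the mixed densities from the consensus marginals. This is a pathwise bound, so that the
consensus densities need not be measurable in the outcome, nor adapted. By the contraction property
the distances `u_t` satisfy `u_{t+1} ≤ σ u_t + K α_t`; hence they are square summable, and
`∑ α_t u_t` is finite (`summable_mul_of_contraction`).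

So `V (t + 1) ≤ V t + c_t` with a convergent series `∑ c_t`, and `V ≥ 0` converges.
-/

/-! ### Marginal densities as push-forwards -/

section Marginals

variable {m : ℕ} {d : Fin m → ℕ} {S T : Finset (Fin m)}

/-- The measure on a space with a reference volume whose density is `p`. -/
noncomputable def densityMeasure {X : Type*} [MeasureSpace X] (p : X → ℝ) : Measure X :=
  volume.withDensity fun x => ENNReal.ofReal (p x)

lemma measurable_restrictVars (h : S ⊆ T) :
    Measurable (restrictVars h : VarSpace d T → VarSpace d S) :=
  measurable_pi_lambda _ fun _ => measurable_pi_apply _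

lemma measurable_glueVars :
    Measurable fun w : VarSpace d S × VarSpace d (T \ S) => (glueVars w.1 w.2 : VarSpace d T) := by
  refine measurable_pi_lambda _ fun v => ?_
  unfold glueVars
  split_ifs
  · exact (measurable_pi_apply _).comp measurable_fst
  · exact (measurable_pi_apply _).comp measurable_snd

lemma restrictVars_glueVars (h : S ⊆ T) (x : VarSpace d S) (y : VarSpace d (T \ S)) :
    restrictVars h (glueVars x y) = x := by
  ext v : 1
  simp [restrictVars, glueVars]

lemma measurePreserving_glueVars (h : S ⊆ T) :
    MeasurePreserving
      (fun w : VarSpace d S × VarSpace d (T \ S) => (glueVars w.1 w.2 : VarSpace d T))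
      (volume.prod volume) volume := by
  refine ⟨measurable_glueVars, ?_⟩
  symm
  refine Measure.pi_eq fun s hs => ?_
  rw [Measure.map_apply measurable_glueVars (MeasurableSet.univ_pi hs)]
  have hpre : (fun w : VarSpace d S × VarSpace d (T \ S) => (glueVars w.1 w.2 : VarSpace d T)) ⁻¹'
      (Set.univ.pi s) =
      (Set.univ.pi fun v : S => s ⟨v.1, h v.2⟩) ×ˢ
      (Set.univ.pi fun v : (T \ S : Finset (Fin m)) => s ⟨v.1, (Finset.mem_sdiff.1 v.2).1⟩) := by
    ext ⟨x, y⟩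
    simp only [Set.mem_preimage, Set.mem_univ_pi, Set.mem_prod, glueVars]
    constructor
    · intro H
      refine ⟨fun v => ?_, fun v => ?_⟩
      · have := H ⟨v.1, h v.2⟩
        simpa using this
      · have := H ⟨v.1, (Finset.mem_sdiff.1 v.2).1⟩
        simpa [(Finset.mem_sdiff.1 v.2).2] using this
    · rintro ⟨H1, H2⟩ ⟨v, hv⟩
      by_cases hvS : v ∈ S
      · simpa [hvS] using H1 ⟨v, hvS⟩
      · simpa [hvS] using H2 ⟨v, Finset.mem_sdiff.2 ⟨hv, hvS⟩⟩
  rw [hpre, Measure.prod_prod, volume_pi_pi, volume_pi_pi]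
  let g : Fin m → ℝ≥0∞ := fun v => if hv : v ∈ T then volume (s ⟨v, hv⟩) else 1
  have e1 : ∏ v : S, volume (s ⟨v.1, h v.2⟩) = ∏ v ∈ S, g v := by
    rw [← Finset.prod_coe_sort S g]
    exact Finset.prod_congr rfl fun v _ => by simp [g, h v.2]
  have e2 : ∏ v : (T \ S : Finset (Fin m)), volume (s ⟨v.1, (Finset.mem_sdiff.1 v.2).1⟩) =
      ∏ v ∈ T \ S, g v := by
    rw [← Finset.prod_coe_sort (T \ S) g]
    exact Finset.prod_congr rfl fun v _ => by simp [g, (Finset.mem_sdiff.1 v.2).1]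
  have e3 : ∏ v : T, volume (s v) = ∏ v ∈ T, g v := by
    rw [← Finset.prod_coe_sort T g]
    exact Finset.prod_congr rfl fun v _ => by simp [g]
  rw [e1, e2, e3, mul_comm, Finset.prod_sdiff h]

lemma marginal_congr_ae (h : S ⊆ T) {p p' : VarSpace d T → ℝ} (hpp : p =ᵐ[volume] p') :
    marginal S p =ᵐ[volume] marginal S p' := by
  have h1 := (measurePreserving_glueVars (d := d) h).quasiMeasurePreserving.ae_eq_comp hpp
  filter_upwards [Measure.ae_ae_of_ae_prod h1] with x hx
  exact integral_congr_ae hx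

variable {p : VarSpace d T → ℝ}

lemma marginal_nonneg (hp : ∀ x, 0 ≤ p x) (x : VarSpace d S) : 0 ≤ marginal S p x :=
  integral_nonneg fun _ => hp _

lemma measurable_marginal (hp : Measurable p) : Measurable (marginal S p) := by
  have : StronglyMeasurable fun w : VarSpace d S × VarSpace d (T \ S) => p (glueVars w.1 w.2) :=
    (hp.comp measurable_glueVars).stronglyMeasurable
  exact this.integral_prod_right.measurable

/-- The density obtained by integrating out variables is the density of the push-forward under
forgetting these variables. -/
lemma map_restrictVars_densityMeasure (h : S ⊆ T) (hm : Measurable p) (hn : ∀ x, 0 ≤ p x)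
    (hi : Integrable p) :
    (densityMeasure p).map (restrictVars h) = densityMeasure (marginal S p) := by
  ext B hB
  have hpre := measurable_restrictVars (d := d) h hB
  rw [Measure.map_apply (measurable_restrictVars h) hB, densityMeasure, densityMeasure,
    withDensity_apply _ hpre, withDensity_apply _ hB, ← lintegral_indicator hpre,
    ← lintegral_indicator hB, ← (measurePreserving_glueVars h).lintegral_comp
      (hm.ennreal_ofReal.indicator hpre), lintegral_prod]
  · have hint := ((measurePreserving_glueVars (d := d) h).integrable_comp
      hm.aestronglyMeasurable).2 hi
    refine lintegral_congr_ae ?_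
    filter_upwards [hint.prod_right_ae] with x hx
    by_cases hxB : x ∈ B
    · simp only [Set.indicator, Set.mem_preimage, restrictVars_glueVars, hxB, if_true]
      exact (ofReal_integral_eq_lintegral_ofReal hx (ae_of_all _ fun _ => hn _)).symm
    · simp [Set.indicator, restrictVars_glueVars, hxB]
  · exact ((hm.ennreal_ofReal.indicator hpre).comp measurable_glueVars).aemeasurable

end Marginals

section DensityMeasure

variable {X : Type*} [MeasureSpace X] {p g : X → ℝ}

lemma IsPDF.isProbabilityMeasure (hp : IsPDF p) : IsProbabilityMeasure (densityMeasure p) :=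
  ⟨by rw [densityMeasure, withDensity_apply _ MeasurableSet.univ, setLIntegral_univ,
      ← ofReal_integral_eq_lintegral_ofReal hp.integrable (ae_of_all _ hp.nonneg),
      hp.integral_eq_one, ENNReal.ofReal_one]⟩

lemma isPDF_of_isProbabilityMeasure (hm : Measurable p) (hn : ∀ x, 0 ≤ p x)
    (h : IsProbabilityMeasure (densityMeasure p)) : IsPDF p := by
  have h1 : ∫⁻ x, ENNReal.ofReal (p x) = 1 := by
    have := h.measure_univ
    rwa [densityMeasure, withDensity_apply _ MeasurableSet.univ, setLIntegral_univ] at this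
  have hi : Integrable p :=
    (lintegral_ofReal_ne_top_iff_integrable hm.aestronglyMeasurable (ae_of_all _ hn)).1
      (by simp [h1])
  refine ⟨hm, hn, hi, ?_⟩
  rw [integral_eq_lintegral_of_nonneg_ae (ae_of_all _ hn) hm.aestronglyMeasurable, h1]
  rfl

lemma integral_densityMeasure (hm : Measurable p) (hn : ∀ x, 0 ≤ p x) (f : X → ℝ) :
    ∫ x, f x ∂(densityMeasure p) = ∫ x, p x * f x := by
  rw [densityMeasure, integral_withDensity_eq_integral_toReal_smul hm.ennreal_ofReal (by simp)]
  simp [ENNReal.toReal_ofReal (hn _)]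

lemma integrable_densityMeasure_iff (hm : Measurable p) (hn : ∀ x, 0 ≤ p x) {f : X → ℝ} :
    Integrable f (densityMeasure p) ↔ Integrable fun x => p x * f x := by
  rw [densityMeasure, integrable_withDensity_iff_integrable_smul' hm.ennreal_ofReal (by simp)]
  simp [ENNReal.toReal_ofReal (hn _)]

lemma ae_densityMeasure_iff (hm : Measurable p) (hn : ∀ x, 0 ≤ p x) {r : X → Prop} :
    (∀ᵐ x ∂(densityMeasure p), r x) ↔ ∀ᵐ x, p x ≠ 0 → r x := by
  rw [densityMeasure, ae_withDensity_iff hm.ennreal_ofReal]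
  refine eventually_congr (ae_of_all _ fun x => ?_)
  rw [ne_eq, ENNReal.ofReal_eq_zero, ne_eq, ← (hn x).ge_iff_eq']

lemma densityMeasure_congr_ae (h : p =ᵐ[volume] g) : densityMeasure p = densityMeasure g :=
  withDensity_congr_ae (h.mono fun x hx => by simp only [hx])

lemma ae_eq_of_densityMeasure_eq [SigmaFinite (volume : Measure X)] (hp : IsPDF p) (hg : IsPDF g)
    (h : densityMeasure p = densityMeasure g) : p =ᵐ[volume] g := by
  have := (withDensity_eq_iff_of_sigmaFinite hp.measurable.ennreal_ofReal.aemeasurable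
    hg.measurable.ennreal_ofReal.aemeasurable).1 h
  filter_upwards [this] with x hx
  exact (ENNReal.ofReal_eq_ofReal_iff (hp.nonneg x) (hg.nonneg x)).1 hx

end DensityMeasure

section Marginals

variable {m : ℕ} {d : Fin m → ℕ} {S T U : Finset (Fin m)} {p g : VarSpace d T → ℝ}

lemma IsPDF.map_restrictVars (hp : IsPDF p) (h : S ⊆ T) :
    (densityMeasure p).map (restrictVars h) = densityMeasure (marginal S p) :=
  map_restrictVars_densityMeasure h hp.measurable hp.nonneg hp.integrable

lemma IsPDF.marginal (hp : IsPDF p) (h : S ⊆ T) : IsPDF (marginal S p) := by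
  refine isPDF_of_isProbabilityMeasure (measurable_marginal hp.measurable)
    (marginal_nonneg hp.nonneg) ?_
  have := hp.isProbabilityMeasure
  rw [← hp.map_restrictVars h]
  exact Measure.isProbabilityMeasure_map (measurable_restrictVars h).aemeasurable

lemma IsPDF.marginal_marginal {p : VarSpace d U → ℝ} (hp : IsPDF p) (h : S ⊆ T) (h' : T ⊆ U) :
    _root_.marginal S (_root_.marginal T p) =ᵐ[volume] _root_.marginal S p := by
  refine ae_eq_of_densityMeasure_eq ((hp.marginal h').marginal h) (hp.marginal (h.trans h')) ?_
  rw [← (hp.marginal h').map_restrictVars h, ← hp.map_restrictVars h',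
    ← hp.map_restrictVars (h.trans h'),
    Measure.map_map (measurable_restrictVars h) (measurable_restrictVars h')]
  rfl

lemma IsPDF.integral_marginal_mul (hp : IsPDF p) (h : S ⊆ T) {f : VarSpace d S → ℝ}
    (hf : Measurable f) :
    ∫ x, _root_.marginal S p x * f x = ∫ x, p x * f (restrictVars h x) := by
  have hm := hp.marginal h
  rw [← integral_densityMeasure hm.measurable hm.nonneg,
    ← integral_densityMeasure hp.measurable hp.nonneg, ← hp.map_restrictVars h,
    integral_map (measurable_restrictVars h).aemeasurable hf.aestronglyMeasurable]

lemma IsPDF.integrable_marginal_mul_iff (hp : IsPDF p) (h : S ⊆ T) {f : VarSpace d S → ℝ}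
    (hf : Measurable f) :
    Integrable (fun x => _root_.marginal S p x * f x) ↔
      Integrable fun x => p x * f (restrictVars h x) := by
  have hm := hp.marginal h
  rw [← integrable_densityMeasure_iff hm.measurable hm.nonneg,
    ← integrable_densityMeasure_iff hp.measurable hp.nonneg, ← hp.map_restrictVars h,
    integrable_map_measure hf.aestronglyMeasurable (measurable_restrictVars h).aemeasurable]
  rfl

lemma IsPDF.ae_marginal_iff (hp : IsPDF p) (h : S ⊆ T) {r : VarSpace d S → Prop}
    (hr : MeasurableSet {x | r x}) :
    (∀ᵐ x, _root_.marginal S p x ≠ 0 → r x) ↔ ∀ᵐ x, p x ≠ 0 → r (restrictVars h x) := by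
  have hm := hp.marginal h
  rw [← ae_densityMeasure_iff hm.measurable hm.nonneg,
    ← ae_densityMeasure_iff hp.measurable hp.nonneg, ← hp.map_restrictVars h,
    ae_map_iff (measurable_restrictVars h).aemeasurable hr]

end Marginals

/-! ### Kullback-Leibler divergences of densities -/

section KullbackLeibler

variable {X : Type*} [MeasureSpace X] {p g h : X → ℝ}

/-- The divergence of `p` from `g` is finite: `p` is absolutely continuous with respect to `g`, and
`p log (p / g)` is integrable. -/
structure HasFiniteKL (p g : X → ℝ) : Prop where
  ac : ∀ᵐ x, p x ≠ 0 → g x ≠ 0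
  integrable : Integrable fun x => p x * Real.log (p x / g x)

/-- The divergence `∫ p log (p / g)` as a real number, meaningful under `HasFiniteKL p g`. -/
noncomputable def klReal (p g : X → ℝ) : ℝ := ∫ x, p x * Real.log (p x / g x)

lemma HasFiniteKL.congr_ae {p' g' : X → ℝ} (hfin : HasFiniteKL p g) (hp : p =ᵐ[volume] p')
    (hg : g =ᵐ[volume] g') : HasFiniteKL p' g' := by
  refine ⟨?_, hfin.integrable.congr ?_⟩
  · filter_upwards [hp, hg, hfin.ac] with x h1 h2 h3
    rwa [← h1, ← h2]
  · filter_upwards [hp, hg] with x h1 h2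
    rw [h1, h2]

lemma klReal_congr_ae {p' g' : X → ℝ} (hp : p =ᵐ[volume] p') (hg : g =ᵐ[volume] g') :
    klReal p g = klReal p' g' := by
  refine integral_congr_ae ?_
  filter_upwards [hp, hg] with x h1 h2
  rw [h1, h2]

lemma kl_congr_ae {p' g' : X → ℝ} (hp : p =ᵐ[volume] p') (hg : g =ᵐ[volume] g') :
    kl p g = kl p' g' := by
  have h1 := densityMeasure_congr_ae hp
  have h2 := densityMeasure_congr_ae hg
  unfold densityMeasure at h1 h2
  rw [kl, kl, h1, h2]

lemma densityMeasure_eq_withDensity (hp : IsPDF p) (hg : IsPDF g)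
    (hac : ∀ᵐ x, p x ≠ 0 → g x ≠ 0) :
    densityMeasure p = (densityMeasure g).withDensity fun x => ENNReal.ofReal (p x / g x) := by
  have hm : Measurable fun x => ENNReal.ofReal (p x / g x) :=
    (hp.measurable.div hg.measurable).ennreal_ofReal
  rw [densityMeasure, densityMeasure, ← withDensity_mul _ hg.measurable.ennreal_ofReal hm]
  refine withDensity_congr_ae ?_
  filter_upwards [hac] with x hx
  rw [Pi.mul_apply, ← ENNReal.ofReal_mul (hg.nonneg x)]
  by_cases h0 : p x = 0
  · simp [h0]
  · rw [mul_div_cancel₀ _ (hx h0)]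

lemma densityMeasure_absolutelyContinuous_iff (hp : IsPDF p) (hg : IsPDF g) :
    densityMeasure p ≪ densityMeasure g ↔ ∀ᵐ x, p x ≠ 0 → g x ≠ 0 := by
  constructor
  · intro hac
    have h1 : ∀ᵐ x ∂(densityMeasure g), g x ≠ 0 :=
      (ae_densityMeasure_iff hg.measurable hg.nonneg).2 (ae_of_all _ fun _ => id)
    exact (ae_densityMeasure_iff hp.measurable hp.nonneg).1 (hac.ae_le h1)
  · intro hac
    rw [densityMeasure_eq_withDensity hp hg hac]
    exact withDensity_absolutelyContinuous _ _

lemma llr_densityMeasure (hp : IsPDF p) (hg : IsPDF g) (hac : ∀ᵐ x, p x ≠ 0 → g x ≠ 0) :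
    llr (densityMeasure p) (densityMeasure g) =ᵐ[densityMeasure p]
      fun x => Real.log (p x / g x) := by
  have := hg.isProbabilityMeasure
  have h1 : (densityMeasure p).rnDeriv (densityMeasure g) =ᵐ[densityMeasure g]
      fun x => ENNReal.ofReal (p x / g x) := by
    conv_lhs => rw [densityMeasure_eq_withDensity hp hg hac]
    exact Measure.rnDeriv_withDensity _ (hp.measurable.div hg.measurable).ennreal_ofReal
  have h2 := ((densityMeasure_absolutelyContinuous_iff hp hg).2 hac).ae_eq h1
  filter_upwards [h2] with x hx
  rw [llr, hx, ENNReal.toReal_ofReal (div_nonneg (hp.nonneg x) (hg.nonneg x))]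

lemma kl_ne_top_iff (hp : IsPDF p) (hg : IsPDF g) : kl p g ≠ ∞ ↔ HasFiniteKL p g := by
  change InformationTheory.klDiv (densityMeasure p) (densityMeasure g) ≠ ∞ ↔ _
  rw [InformationTheory.klDiv_ne_top_iff, densityMeasure_absolutelyContinuous_iff hp hg]
  constructor
  · rintro ⟨hac, hi⟩
    exact ⟨hac, (integrable_densityMeasure_iff hp.measurable hp.nonneg).1
      (hi.congr (llr_densityMeasure hp hg hac))⟩
  · rintro ⟨hac, hi⟩
    exact ⟨hac, ((integrable_densityMeasure_iff hp.measurable hp.nonneg).2 hi).congr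
      (llr_densityMeasure hp hg hac).symm⟩

lemma HasFiniteKL.kl_eq (hfin : HasFiniteKL p g) (hp : IsPDF p) (hg : IsPDF g) :
    kl p g = ENNReal.ofReal (klReal p g) := by
  have h1 := hp.isProbabilityMeasure
  have h2 := hg.isProbabilityMeasure
  change InformationTheory.klDiv (densityMeasure p) (densityMeasure g) = _
  rw [InformationTheory.klDiv_of_ac_of_integrable
    ((densityMeasure_absolutelyContinuous_iff hp hg).2 hfin.ac)
    (((integrable_densityMeasure_iff hp.measurable hp.nonneg).2 hfin.integrable).congr
      (llr_densityMeasure hp hg hfin.ac).symm),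
    integral_congr_ae (llr_densityMeasure hp hg hfin.ac),
    integral_densityMeasure hp.measurable hp.nonneg]
  simp [klReal]

lemma HasFiniteKL.klReal_nonneg (hfin : HasFiniteKL p g) (hp : IsPDF p) (hg : IsPDF g) :
    0 ≤ klReal p g := by
  have h1 := hp.isProbabilityMeasure
  have h2 := hg.isProbabilityMeasure
  have := InformationTheory.integral_llr_add_sub_measure_univ_nonneg
    ((densityMeasure_absolutelyContinuous_iff hp hg).2 hfin.ac)
    (((integrable_densityMeasure_iff hp.measurable hp.nonneg).2 hfin.integrable).congr
      (llr_densityMeasure hp hg hfin.ac).symm)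
  rw [integral_congr_ae (llr_densityMeasure hp hg hfin.ac),
    integral_densityMeasure hp.measurable hp.nonneg] at this
  simpa [klReal] using this

/-- Replacing the reference density `g` by `h` changes `p log (p / g)` by `p log (h / g)`. -/
lemma HasFiniteKL.change_right (hfin : HasFiniteKL p g) (hac : ∀ᵐ x, p x ≠ 0 → h x ≠ 0)
    (hi : Integrable fun x => p x * Real.log (h x / g x)) :
    HasFiniteKL p h ∧ klReal p h = klReal p g - ∫ x, p x * Real.log (h x / g x) := by
  have heq : (fun x => p x * Real.log (p x / h x)) =ᵐ[volume]
      fun x => p x * Real.log (p x / g x) - p x * Real.log (h x / g x) := by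
    filter_upwards [hac, hfin.ac] with x h1 h2
    by_cases h0 : p x = 0
    · simp [h0]
    · rw [Real.log_div h0 (h1 h0), Real.log_div h0 (h2 h0), Real.log_div (h1 h0) (h2 h0)]
      ring
  refine ⟨⟨hac, (hfin.integrable.sub hi).congr heq.symm⟩, ?_⟩
  rw [klReal, integral_congr_ae heq, integral_sub hfin.integrable hi, klReal]

lemma HasFiniteKL.marginal {m : ℕ} {d : Fin m → ℕ} {S T : Finset (Fin m)}
    {p g : VarSpace d T → ℝ} (hfin : HasFiniteKL p g) (hp : IsPDF p) (hg : IsPDF g)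
    (hST : S ⊆ T) : HasFiniteKL (marginal S p) (marginal S g) := by
  have h1 := hp.isProbabilityMeasure
  have h2 := hg.isProbabilityMeasure
  rw [← kl_ne_top_iff (hp.marginal hST) (hg.marginal hST)]
  have h3 := InformationTheory.klDiv_map_le (densityMeasure p) (densityMeasure g)
    (measurable_restrictVars (d := d) hST)
  rw [hp.map_restrictVars hST, hg.map_restrictVars hST] at h3
  exact ne_top_of_le_ne_top ((kl_ne_top_iff hp hg).2 hfin) h3

end KullbackLeibler

/-! ### Geometric pooling and edge merging -/

section Mixing

variable {X : Type*} [MeasureSpace X]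

/-- Pooling subprobability densities by a weighted geometric mean and normalizing does not increase
the average divergence: the normalizing constant is at most one by the inequality of the arithmetic
and geometric means. -/
lemma geometric_pooling_spec {ι : Type*} [Fintype ι] {p : X → ℝ} (hp : IsPDF p) {r : ι → X → ℝ}
    (hm : ∀ j, Measurable (r j)) (hn : ∀ j x, 0 ≤ r j x) (hi : ∀ j, Integrable (r j))
    (h1 : ∀ j, ∫ x, r j x ≤ 1) (hfin : ∀ j, HasFiniteKL p (r j)) {a : ι → ℝ}
    (ha : ∀ j, 0 ≤ a j) (hsum : ∑ j, a j = 1) {v : X → ℝ}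
    (hv : v = fun x => (∏ j, r j x ^ a j) / ∫ y, ∏ j, r j y ^ a j) :
    IsPDF v ∧ HasFiniteKL p v ∧ klReal p v ≤ ∑ j, a j * klReal p (r j) := by
  set w : X → ℝ := fun x => ∏ j, r j x ^ a j with hw
  have hwm : Measurable w :=
    Finset.measurable_prod _ fun j _ => (hm j).pow_const _
  have hwn : ∀ x, 0 ≤ w x := fun x =>
    Finset.prod_nonneg fun j _ => Real.rpow_nonneg (hn j x) _
  have hwle : ∀ x, w x ≤ ∑ j, a j * r j x := fun x =>
    Real.geom_mean_le_arith_mean_weighted _ _ _ (fun j _ => ha j) hsum fun j _ => hn j x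
  have hSi : Integrable fun x => ∑ j, a j * r j x :=
    integrable_finsetSum _ fun j _ => (hi j).const_mul _
  have hwi : Integrable w := hSi.mono' hwm.aestronglyMeasurable
    (ae_of_all _ fun x => by rw [Real.norm_of_nonneg (hwn x)]; exact hwle x)
  have hall : ∀ᵐ x, p x ≠ 0 → ∀ j, r j x ≠ 0 := by
    filter_upwards [ae_all_iff.2 fun j => (hfin j).ac] with x hx h0 j using hx j h0
  have hwpos : ∀ᵐ x, p x ≠ 0 → 0 < w x := by
    filter_upwards [hall] with x hx h0
    exact Finset.prod_pos fun j _ => Real.rpow_pos_of_pos ((hn j x).lt_of_ne' (hx h0 j)) _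
  set Zw : ℝ := ∫ y, w y with hZw
  have hZ1 : Zw ≤ 1 := by
    calc Zw ≤ ∫ x, ∑ j, a j * r j x := integral_mono hwi hSi hwle
      _ = ∑ j, a j * ∫ x, r j x := by
        rw [integral_finsetSum _ fun j _ => (hi j).const_mul _]
        simp_rw [integral_const_mul]
      _ ≤ ∑ j, a j * 1 := Finset.sum_le_sum fun j _ => mul_le_mul_of_nonneg_left (h1 j) (ha j)
      _ = 1 := by simpa using hsum
  have hZpos : 0 < Zw := by
    refine (integral_nonneg hwn).lt_of_ne' fun h0 => ?_
    have hw0 := (integral_eq_zero_iff_of_nonneg hwn hwi).1 h0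
    have hp0 : p =ᵐ[volume] 0 := by
      filter_upwards [hw0, hwpos] with x hx1 hx2
      by_contra h
      exact (hx2 h).ne' hx1
    have := hp.integral_eq_one
    rw [integral_congr_ae hp0] at this
    simp at this
  have hvx : ∀ x, v x = w x / Zw := fun x => by rw [hv]
  have hvpdf : IsPDF v := by
    rw [hv]
    refine ⟨hwm.div_const _, fun x => div_nonneg (hwn x) hZpos.le, hwi.div_const _, ?_⟩
    rw [integral_div]
    exact div_self hZpos.ne'
  have heq : (fun x => p x * Real.log (p x / v x)) =ᵐ[volume]
      fun x => (∑ j, a j * (p x * Real.log (p x / r j x))) + p x * Real.log Zw := by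
    filter_upwards [hall, hwpos] with x hx hx2
    by_cases h0 : p x = 0
    · simp [h0]
    have hlw : Real.log (w x) = ∑ j, a j * Real.log (r j x) := by
      rw [hw]
      simp only
      rw [Real.log_prod fun j _ =>
        (Real.rpow_pos_of_pos ((hn j x).lt_of_ne' (hx h0 j)) _).ne']
      exact Finset.sum_congr rfl fun j _ => Real.log_rpow ((hn j x).lt_of_ne' (hx h0 j)) _
    have hsplit : ∑ j, a j * (p x * Real.log (p x / r j x)) =
        p x * Real.log (p x) - p x * ∑ j, a j * Real.log (r j x) := by
      calc ∑ j, a j * (p x * Real.log (p x / r j x))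
          = ∑ j, (a j * (p x * Real.log (p x)) - p x * (a j * Real.log (r j x))) :=
            Finset.sum_congr rfl fun j _ => by rw [Real.log_div h0 (hx h0 j)]; ring
        _ = _ := by
            rw [Finset.sum_sub_distrib, ← Finset.sum_mul, hsum, one_mul, ← Finset.mul_sum]
    rw [hsplit, ← hlw, hvx, Real.log_div h0 (div_pos (hx2 h0) hZpos).ne',
      Real.log_div (hx2 h0).ne' hZpos.ne']
    ring
  have hI1 : Integrable fun x => ∑ j, a j * (p x * Real.log (p x / r j x)) :=
    integrable_finsetSum _ fun j _ => (hfin j).integrable.const_mul _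
  have hI2 : Integrable fun x => p x * Real.log Zw := hp.integrable.mul_const _
  refine ⟨hvpdf, ⟨?_, (hI1.add hI2).congr heq.symm⟩, ?_⟩
  · filter_upwards [hwpos] with x hx h0
    rw [hvx]
    exact (div_pos (hx h0) hZpos).ne'
  · rw [klReal, integral_congr_ae heq, integral_add hI1 hI2, integral_mul_const,
      hp.integral_eq_one, one_mul, integral_finsetSum _ fun j _ =>
        (hfin j).integrable.const_mul _]
    simp_rw [integral_const_mul]
    have := Real.log_nonpos hZpos.le hZ1
    simp only [klReal]
    linarith

variable {m : ℕ} {d : Fin m → ℕ}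

/-- Replacing the marginal of `g` over the variables in `S` by `b` changes the divergence of `p`
from `g` by the difference of the divergences of the marginals. -/
lemma marginal_replacement_spec {S T : Finset (Fin m)} (hST : S ⊆ T) {p g : VarSpace d T → ℝ}
    {b : VarSpace d S → ℝ} (hp : IsPDF p) (hg : IsPDF g) (hb : IsPDF b) (hpg : HasFiniteKL p g)
    (hpb : HasFiniteKL (marginal S p) b) {r : VarSpace d T → ℝ}
    (hr : r = fun x => g x / marginal S g (restrictVars hST x) * b (restrictVars hST x)) :
    Measurable r ∧ (∀ x, 0 ≤ r x) ∧ Integrable r ∧ ∫ x, r x ≤ 1 ∧ HasFiniteKL p r ∧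
      klReal p r = klReal p g - klReal (marginal S p) (marginal S g) +
        klReal (marginal S p) b := by
  have hR := measurable_restrictVars (d := d) hST
  have hgm := hg.marginal hST
  have hpm := hp.marginal hST
  have hf : Measurable fun x => b x / marginal S g x := hb.measurable.div hgm.measurable
  have hr' : ∀ x, r x = g x * (b (restrictVars hST x) / marginal S g (restrictVars hST x)) :=
    fun x => by rw [hr]; ring
  have hrm : Measurable r := by
    rw [hr]
    exact (hg.measurable.div (hgm.measurable.comp hR)).mul (hb.measurable.comp hR)
  have hle : ∀ x, marginal S g x * (b x / marginal S g x) ≤ b x := fun x => by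
    by_cases h0 : marginal S g x = 0
    · simpa [h0] using hb.nonneg x
    · rw [mul_div_cancel₀ _ h0]
  have hI : Integrable fun x => marginal S g x * (b x / marginal S g x) :=
    hb.integrable.mono' (hgm.measurable.mul hf).aestronglyMeasurable (ae_of_all _ fun x => by
      rw [Real.norm_of_nonneg (mul_nonneg (hgm.nonneg x) (div_nonneg (hb.nonneg x) (hgm.nonneg x)))]
      exact hle x)
  have hmfin := hpg.marginal hp hg hST
  have hac : ∀ᵐ x, p x ≠ 0 → r x ≠ 0 := by
    have h1 := (hp.ae_marginal_iff hST (r := fun x => b x ≠ 0)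
      (hb.measurable (measurableSet_singleton 0).compl)).1 hpb.ac
    have h2 := (hp.ae_marginal_iff hST (r := fun x => marginal S g x ≠ 0)
      (hgm.measurable (measurableSet_singleton 0).compl)).1 hmfin.ac
    filter_upwards [h1, h2, hpg.ac] with x a1 a2 a3 h0
    rw [hr']
    exact mul_ne_zero (a3 h0) (div_ne_zero (a1 h0) (a2 h0))
  have heq : (fun x => p x * Real.log (r x / g x)) =ᵐ[volume] fun x =>
      p x * Real.log (b (restrictVars hST x) / marginal S g (restrictVars hST x)) := by
    filter_upwards [hpg.ac] with x hx
    by_cases h0 : p x = 0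
    · simp [h0]
    · rw [hr', mul_div_cancel_left₀ _ (hx h0)]
  have heq2 : (fun x => marginal S p x * Real.log (b x / marginal S g x)) =ᵐ[volume] fun x =>
      marginal S p x * Real.log (marginal S p x / marginal S g x) -
        marginal S p x * Real.log (marginal S p x / b x) := by
    filter_upwards [hpb.ac, hmfin.ac] with x h1 h2
    by_cases h0 : marginal S p x = 0
    · simp [h0]
    · rw [Real.log_div (h1 h0) (h2 h0), Real.log_div h0 (h2 h0), Real.log_div h0 (h1 h0)]
      ring
  have hi : Integrable fun x => p x * Real.log (r x / g x) := by
    refine Integrable.congr ?_ heq.symm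
    refine (hp.integrable_marginal_mul_iff hST
      (f := fun x => Real.log (b x / marginal S g x)) hf.log).1 ?_
    exact (hmfin.integrable.sub hpb.integrable).congr heq2.symm
  obtain ⟨h1, h2⟩ := hpg.change_right hac hi
  refine ⟨hrm, fun x => ?_, ?_, ?_, h1, ?_⟩
  · rw [hr']
    exact mul_nonneg (hg.nonneg x) (div_nonneg (hb.nonneg _) (hgm.nonneg _))
  · simp_rw [funext hr']
    exact (hg.integrable_marginal_mul_iff hST hf).1 hI
  · simp_rw [hr']
    rw [← hg.integral_marginal_mul hST hf, ← hb.integral_eq_one]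
    exact integral_mono hI hb.integrable hle
  · rw [h2, integral_congr_ae heq, ← hp.integral_marginal_mul hST
      (f := fun x => Real.log (b x / marginal S g x)) hf.log, integral_congr_ae heq2,
      integral_sub hmfin.integrable hpb.integrable]
    simp only [klReal]
    ring

variable {n : ℕ} {S : Fin n → Finset (Fin m)}

lemma edgeMerge_congr_ae {p p' : ∀ i, VarSpace d (S i) → ℝ}
    (h : ∀ i, p i =ᵐ[volume] p' i) (hp : ∀ i, IsPDF (p i)) (hp' : ∀ i, IsPDF (p' i)) (i j : Fin n) :
    edgeMerge p i j =ᵐ[volume] edgeMerge p' i j := by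
  have hi := marginal_congr_ae (Finset.inter_subset_left (s₁ := S i) (s₂ := S j)) (h i)
  have hj := marginal_congr_ae (Finset.inter_subset_right (s₁ := S i) (s₂ := S j)) (h j)
  -- the shared marginals agree up to a null set in the shared variables, whose preimage is
  -- negligible for the density `p i`
  have key : ∀ᵐ x, p i x ≠ 0 →
      marginal (S i ∩ S j) (p i) (restrictVars Finset.inter_subset_left x) =
        marginal (S i ∩ S j) (p' i) (restrictVars Finset.inter_subset_left x) ∧
      marginal (S i ∩ S j) (p j) (restrictVars Finset.inter_subset_left x) =
        marginal (S i ∩ S j) (p' j) (restrictVars Finset.inter_subset_left x) := by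
    refine ((hp i).ae_marginal_iff Finset.inter_subset_left (r := fun y =>
      marginal (S i ∩ S j) (p i) y = marginal (S i ∩ S j) (p' i) y ∧
      marginal (S i ∩ S j) (p j) y = marginal (S i ∩ S j) (p' j) y) ?_).1 ?_
    · exact (measurableSet_eq_fun (measurable_marginal (hp i).measurable)
        (measurable_marginal (hp' i).measurable)).inter
        (measurableSet_eq_fun (measurable_marginal (hp j).measurable)
        (measurable_marginal (hp' j).measurable))
    · filter_upwards [hi, hj] with y h1 h2 _ using ⟨h1, h2⟩
  filter_upwards [h i, key] with x h1 h2
  unfold edgeMerge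
  by_cases h0 : p i x = 0
  · rw [← h1, h0, zero_div, zero_div, zero_mul, zero_mul]
  · rw [(h2 h0).1, (h2 h0).2, h1]

lemma mixed_congr_ae {A : Matrix (Fin n) (Fin n) ℝ} {p p' : ∀ i, VarSpace d (S i) → ℝ}
    (h : ∀ i, p i =ᵐ[volume] p' i) (hp : ∀ i, IsPDF (p i)) (hp' : ∀ i, IsPDF (p' i)) (i : Fin n) :
    mixed A p i =ᵐ[volume] mixed A p' i := by
  have h1 : (fun x => ∏ j, edgeMerge p i j x ^ A i j) =ᵐ[volume]
      fun x => ∏ j, edgeMerge p' i j x ^ A i j := by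
    filter_upwards [ae_all_iff.2 fun j => edgeMerge_congr_ae h hp hp' i j] with x hx
    simp_rw [hx]
  filter_upwards [h1] with x hx
  rw [mixed, mixed, hx, integral_congr_ae h1]

/-- Mixing produces densities and does not increase the total divergence from the marginals of a
joint density: by the symmetry of `A`, the divergences of the shared marginals cancel in
the sum over the agents. -/
lemma mixed_spec {A : Matrix (Fin n) (Fin n) ℝ} (hA0 : ∀ i j, 0 ≤ A i j)
    (hAs : A.transpose = A) (hA1 : ∀ i, ∑ j, A i j = 1) {P : VarSpace d Finset.univ → ℝ}
    (hP : IsPDF P) {p : ∀ i, VarSpace d (S i) → ℝ} (hp : ∀ i, IsPDF (p i))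
    (hfin : ∀ i, HasFiniteKL (marginal (S i) P) (p i)) :
    (∀ i, IsPDF (mixed A p i)) ∧ (∀ i, HasFiniteKL (marginal (S i) P) (mixed A p i)) ∧
      ∑ i, klReal (marginal (S i) P) (mixed A p i) ≤ ∑ i, klReal (marginal (S i) P) (p i) := by
  have hPi : ∀ i, IsPDF (marginal (S i) P) := fun i => hP.marginal (Finset.subset_univ _)
  have hmm : ∀ U i, U ⊆ S i → marginal U (marginal (S i) P) =ᵐ[volume] marginal U P :=
    fun U i hU => hP.marginal_marginal hU (Finset.subset_univ _)
  have hU : ∀ U i, U ⊆ S i → HasFiniteKL (marginal U P) (marginal U (p i)) := fun U i hU =>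
    ((hfin i).marginal (hPi i) (hp i) hU).congr_ae (hmm U i hU) EventuallyEq.rfl
  have hr := fun i j => marginal_replacement_spec (Finset.inter_subset_left (s₁ := S i) (s₂ := S j))
    (hPi i) (hp i) ((hp j).marginal (Finset.inter_subset_right (s₁ := S i))) (hfin i)
    ((hU _ j Finset.inter_subset_right).congr_ae (hmm _ i Finset.inter_subset_left).symm
      EventuallyEq.rfl) (r := edgeMerge p i j) rfl
  have hpool := fun i => geometric_pooling_spec (hPi i) (fun j => (hr i j).1)
    (fun j => (hr i j).2.1)
    (fun j => (hr i j).2.2.1) (fun j => (hr i j).2.2.2.1) (fun j => (hr i j).2.2.2.2.1)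
    (hA0 i) (hA1 i) (v := mixed A p i) rfl
  refine ⟨fun i => (hpool i).1, fun i => (hpool i).2.1, ?_⟩
  let D : Fin n → Fin n → Fin n → ℝ := fun i j k =>
    klReal (marginal (S i ∩ S j) P) (marginal (S i ∩ S j) (p k))
  have hDsymm : ∀ i j k, D i j k = D j i k := fun i j k => by
    simp only [D]
    rw [Finset.inter_comm]
  have hr2 : ∀ i j, klReal (marginal (S i) P) (edgeMerge p i j) =
      klReal (marginal (S i) P) (p i) - D i j i + D i j j := fun i j => by
    rw [(hr i j).2.2.2.2.2, klReal_congr_ae (hmm _ i Finset.inter_subset_left) EventuallyEq.rfl,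
      klReal_congr_ae (hmm _ i Finset.inter_subset_left) EventuallyEq.rfl]
  have hAsymm : ∀ i j, A i j = A j i := fun i j => by
    conv_lhs => rw [← hAs]
    rfl
  have hcancel : ∑ i, ∑ j, A i j * D i j j = ∑ i, ∑ j, A i j * D i j i := by
    rw [Finset.sum_comm]
    refine Finset.sum_congr rfl fun i _ => Finset.sum_congr rfl fun j _ => ?_
    rw [hAsymm, hDsymm]
  calc ∑ i, klReal (marginal (S i) P) (mixed A p i)
      ≤ ∑ i, ∑ j, A i j * klReal (marginal (S i) P) (edgeMerge p i j) :=
        Finset.sum_le_sum fun i _ => (hpool i).2.2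
    _ = ∑ i, (klReal (marginal (S i) P) (p i) - ∑ j, A i j * D i j i + ∑ j, A i j * D i j j) := by
        refine Finset.sum_congr rfl fun i _ => ?_
        simp_rw [hr2, mul_add, mul_sub, Finset.sum_add_distrib, Finset.sum_sub_distrib,
          ← Finset.sum_mul, hA1, one_mul]
    _ = ∑ i, klReal (marginal (S i) P) (p i) := by
        rw [Finset.sum_add_distrib, Finset.sum_sub_distrib, hcancel]
        ring

end Mixing

/-! ### The mirror descent step -/

section MirrorStep

lemma abs_const_mul_le {X : Type*} {a L : ℝ} {f : X → ℝ} (ha : 0 ≤ a) (hfL : ∀ x, |f x| ≤ L)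
    (x : X) : |a * f x| ≤ a * L := by
  rw [abs_mul, abs_of_nonneg ha]
  exact mul_le_mul_of_nonneg_left (hfL x) ha

variable {X : Type*} [MeasureSpace X]

/-- The exponential tilt of the density `v` by `a f`: the closed form of a mirror descent step with
step size `a` and log-likelihood `f`. -/
noncomputable def expTilt (a : ℝ) (f v : X → ℝ) : X → ℝ :=
  fun x => Real.exp (a * f x) * v x / ∫ y, Real.exp (a * f y) * v y

variable {a L : ℝ} {f v p : X → ℝ}

lemma integrable_mul_of_bounded (hp : Integrable p) (hf : Measurable f) (hfL : ∀ x, |f x| ≤ L) :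
    Integrable fun x => p x * f x :=
  hp.mul_bdd (c := L) hf.aestronglyMeasurable (ae_of_all _ hfL)

lemma integrable_exp_mul_density (ha : 0 ≤ a) (hf : Measurable f) (hfL : ∀ x, |f x| ≤ L)
    (hv : IsPDF v) : Integrable fun x => Real.exp (a * f x) * v x := by
  refine hv.integrable.bdd_mul (c := Real.exp (a * L))
    (hf.const_mul a).exp.aestronglyMeasurable (ae_of_all _ fun x => ?_)
  rw [Real.norm_of_nonneg (Real.exp_pos _).le]
  exact Real.exp_le_exp.2 ((le_abs_self _).trans (abs_const_mul_le ha hfL x))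

lemma exp_neg_le_integral_exp_mul (ha : 0 ≤ a) (hf : Measurable f) (hfL : ∀ x, |f x| ≤ L)
    (hv : IsPDF v) : Real.exp (-(a * L)) ≤ ∫ y, Real.exp (a * f y) * v y := by
  calc Real.exp (-(a * L)) = ∫ y, Real.exp (-(a * L)) * v y := by
        rw [integral_const_mul, hv.integral_eq_one, mul_one]
    _ ≤ _ := integral_mono (hv.integrable.const_mul _) (integrable_exp_mul_density ha hf hfL hv)
        fun y => mul_le_mul_of_nonneg_right
          (Real.exp_le_exp.2 (abs_le.1 (abs_const_mul_le ha hfL y)).1) (hv.nonneg y)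

lemma integral_exp_mul_le_exp (ha : 0 ≤ a) (hf : Measurable f) (hfL : ∀ x, |f x| ≤ L)
    (hv : IsPDF v) : ∫ y, Real.exp (a * f y) * v y ≤ Real.exp (a * L) := by
  calc ∫ y, Real.exp (a * f y) * v y ≤ ∫ y, Real.exp (a * L) * v y :=
        integral_mono (integrable_exp_mul_density ha hf hfL hv) (hv.integrable.const_mul _)
        fun y => mul_le_mul_of_nonneg_right
          (Real.exp_le_exp.2 (abs_le.1 (abs_const_mul_le ha hfL y)).2) (hv.nonneg y)
    _ = _ := by rw [integral_const_mul, hv.integral_eq_one, mul_one]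

lemma integral_exp_mul_pos (ha : 0 ≤ a) (hf : Measurable f) (hfL : ∀ x, |f x| ≤ L)
    (hv : IsPDF v) : 0 < ∫ y, Real.exp (a * f y) * v y :=
  (Real.exp_pos _).trans_le (exp_neg_le_integral_exp_mul ha hf hfL hv)

lemma isPDF_expTilt (ha : 0 ≤ a) (hf : Measurable f) (hfL : ∀ x, |f x| ≤ L) (hv : IsPDF v) :
    IsPDF (expTilt a f v) := by
  have hZ := integral_exp_mul_pos ha hf hfL hv
  refine ⟨((hf.const_mul a).exp.mul hv.measurable).div_const _, fun x => ?_,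
    (integrable_exp_mul_density ha hf hfL hv).div_const _, ?_⟩
  · exact div_nonneg (mul_nonneg (Real.exp_pos _).le (hv.nonneg x)) hZ.le
  · unfold expTilt
    rw [integral_div]
    exact div_self hZ.ne'

lemma log_expTilt_div (ha : 0 ≤ a) (hf : Measurable f) (hfL : ∀ x, |f x| ≤ L) (hv : IsPDF v)
    {x : X} (hx : v x ≠ 0) :
    Real.log (expTilt a f v x / v x) = a * f x - Real.log (∫ y, Real.exp (a * f y) * v y) := by
  have hZ := integral_exp_mul_pos ha hf hfL hv
  rw [show expTilt a f v x / v x =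
    Real.exp (a * f x) / ∫ y, Real.exp (a * f y) * v y by unfold expTilt; field_simp,
    Real.log_div (Real.exp_pos _).ne' hZ.ne', Real.log_exp]

/-- The divergence after a mirror descent step. -/
lemma klReal_expTilt (ha : 0 ≤ a) (hf : Measurable f) (hfL : ∀ x, |f x| ≤ L) (hv : IsPDF v)
    (hp : IsPDF p) (hfin : HasFiniteKL p v) :
    HasFiniteKL p (expTilt a f v) ∧ klReal p (expTilt a f v) =
      klReal p v - a * (∫ x, p x * f x) + Real.log (∫ y, Real.exp (a * f y) * v y) := by
  have hZ := integral_exp_mul_pos ha hf hfL hv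
  set lz := Real.log (∫ y, Real.exp (a * f y) * v y) with hlz
  have heq : (fun x => p x * Real.log (expTilt a f v x / v x)) =ᵐ[volume]
      fun x => a * (p x * f x) - p x * lz := by
    filter_upwards [hfin.ac] with x hx
    by_cases h0 : p x = 0
    · simp [h0]
    · rw [log_expTilt_div ha hf hfL hv (hx h0)]
      ring
  have h1 : Integrable fun x => a * (p x * f x) :=
    (integrable_mul_of_bounded hp.integrable hf hfL).const_mul a
  have h2 : Integrable fun x => p x * lz := hp.integrable.mul_const _
  have hac : ∀ᵐ x, p x ≠ 0 → expTilt a f v x ≠ 0 := by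
    filter_upwards [hfin.ac] with x hx h0
    exact div_ne_zero (mul_ne_zero (Real.exp_pos _).ne' (hx h0)) hZ.ne'
  obtain ⟨h3, h4⟩ := hfin.change_right hac ((h1.sub h2).congr heq.symm)
  refine ⟨h3, ?_⟩
  rw [h4, integral_congr_ae heq, integral_sub h1 h2, integral_const_mul, integral_mul_const,
    hp.integral_eq_one]
  ring

lemma expTilt_hasFiniteKL (ha : 0 ≤ a) (hf : Measurable f) (hfL : ∀ x, |f x| ≤ L) (hv : IsPDF v) :
    HasFiniteKL (expTilt a f v) v ∧ klReal (expTilt a f v) v =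
      a * (∫ x, expTilt a f v x * f x) - Real.log (∫ y, Real.exp (a * f y) * v y) := by
  set lz := Real.log (∫ y, Real.exp (a * f y) * v y) with hlz
  have ht := isPDF_expTilt ha hf hfL hv
  have h0 : ∀ x, expTilt a f v x ≠ 0 → v x ≠ 0 := fun x hx hv0 => hx (by simp [expTilt, hv0])
  have heq : (fun x => expTilt a f v x * Real.log (expTilt a f v x / v x)) =
      fun x => a * (expTilt a f v x * f x) - expTilt a f v x * lz := by
    funext x
    by_cases h : expTilt a f v x = 0
    · simp [h]
    · rw [log_expTilt_div ha hf hfL hv (h0 x h)]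
      ring
  have h1 : Integrable fun x => a * (expTilt a f v x * f x) :=
    (integrable_mul_of_bounded ht.integrable hf hfL).const_mul a
  have h2 : Integrable fun x => expTilt a f v x * lz := ht.integrable.mul_const _
  refine ⟨⟨ae_of_all _ h0, heq ▸ h1.sub h2⟩, ?_⟩
  rw [klReal, heq, integral_sub h1 h2, integral_const_mul, integral_mul_const, ht.integral_eq_one,
    one_mul]

/-- Hoeffding's lemma for the normalizing constant of a mirror descent step. -/
lemma log_integral_exp_mul_le (ha : 0 ≤ a) (hf : Measurable f) (hfL : ∀ x, |f x| ≤ L)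
    (hv : IsPDF v) :
    Real.log (∫ y, Real.exp (a * f y) * v y) ≤ a * (∫ x, v x * f x) + a ^ 2 * L ^ 2 / 2 := by
  have hprob := hv.isProbabilityMeasure
  have hH := (hasSubgaussianMGF_of_mem_Icc (μ := densityMeasure v) (a := -L) (b := L)
    hf.aemeasurable (ae_of_all _ fun x => abs_le.1 (hfL x))).mgf_le a
  rw [integral_densityMeasure hv.measurable hv.nonneg] at hH
  set c := ∫ x, v x * f x
  have hmgf : mgf (fun x => f x - c) (densityMeasure v) a =
      Real.exp (-(a * c)) * ∫ y, Real.exp (a * f y) * v y := by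
    rw [mgf, integral_densityMeasure hv.measurable hv.nonneg, ← integral_const_mul]
    refine integral_congr_ae (ae_of_all _ fun x => ?_)
    simp only
    rw [show a * (f x - c) = -(a * c) + a * f x by ring, Real.exp_add]
    ring
  rw [hmgf] at hH
  have hZ := integral_exp_mul_pos ha hf hfL hv
  have h2 := Real.log_le_log (mul_pos (Real.exp_pos _) hZ) hH
  rw [Real.log_mul (Real.exp_pos _).ne' hZ.ne', Real.log_exp, Real.log_exp] at h2
  have h3 : (((‖L - -L‖₊ / 2) ^ 2 : ℝ≥0) : ℝ) = L ^ 2 := by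
    push_cast
    rw [Real.norm_eq_abs, div_pow, sq_abs]
    ring
  rw [h3] at h2
  linarith

lemma integral_abs_expTilt_sub_le (ha : 0 ≤ a) (hf : Measurable f) (hfL : ∀ x, |f x| ≤ L)
    (hv : IsPDF v) :
    ∫ x, |expTilt a f v x - v x| ≤ Real.exp (2 * (a * L)) - 1 := by
  have hZ := integral_exp_mul_pos ha hf hfL hv
  have hZ1 := exp_neg_le_integral_exp_mul ha hf hfL hv
  have hZ2 := integral_exp_mul_le_exp ha hf hfL hv
  have ht := isPDF_expTilt ha hf hfL hv
  calc ∫ x, |expTilt a f v x - v x| ≤ ∫ x, (Real.exp (2 * (a * L)) - 1) * v x := by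
        refine integral_mono (ht.integrable.sub hv.integrable).abs (hv.integrable.const_mul _)
          fun x => ?_
        have e1 : expTilt a f v x - v x =
            (Real.exp (a * f x) / (∫ y, Real.exp (a * f y) * v y) - 1) * v x := by
          unfold expTilt
          ring
        simp only [e1, abs_mul, abs_of_nonneg (hv.nonneg x)]
        refine mul_le_mul_of_nonneg_right ?_ (hv.nonneg x)
        -- the density ratio lies between `exp (-2aL)` and `exp (2aL)`
        have hup : Real.exp (a * f x) / (∫ y, Real.exp (a * f y) * v y) ≤
            Real.exp (2 * (a * L)) := by
          rw [div_le_iff₀ hZ]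
          calc Real.exp (a * f x) ≤ Real.exp (a * L) :=
                Real.exp_le_exp.2 (abs_le.1 (abs_const_mul_le ha hfL x)).2
            _ = Real.exp (2 * (a * L)) * Real.exp (-(a * L)) := by
                rw [← Real.exp_add]
                ring_nf
            _ ≤ _ := mul_le_mul_of_nonneg_left hZ1 (Real.exp_pos _).le
        have hlo : Real.exp (-(2 * (a * L))) ≤
            Real.exp (a * f x) / (∫ y, Real.exp (a * f y) * v y) := by
          rw [le_div_iff₀ hZ]
          calc Real.exp (-(2 * (a * L))) * (∫ y, Real.exp (a * f y) * v y)
              ≤ Real.exp (-(2 * (a * L))) * Real.exp (a * L) :=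
                mul_le_mul_of_nonneg_left hZ2 (Real.exp_pos _).le
            _ = Real.exp (-(a * L)) := by
                rw [← Real.exp_add]
                ring_nf
            _ ≤ _ := Real.exp_le_exp.2 (abs_le.1 (abs_const_mul_le ha hfL x)).1
        have h3 := Real.add_one_le_exp (2 * (a * L))
        have h4 := Real.add_one_le_exp (-(2 * (a * L)))
        rw [abs_le]
        constructor <;> linarith
    _ = _ := by rw [integral_const_mul, hv.integral_eq_one, mul_one]

/-- The mirror descent step has the exponential tilt as its only solution: the objective at `p`
is the divergence of `p` from the tilt, up to a constant. -/
lemma ae_eq_expTilt_of_forall_le [SigmaFinite (volume : Measure X)] {E : Type*} {q : E → X → ℝ}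
    {z : E} (ha : 0 ≤ a) (hf : Measurable f) (hfL : ∀ x, |f x| ≤ L)
    (hfq : ∀ x, Real.log (q z x) = f x) (hv : IsPDF v) (hp : IsPDF p)
    (hmin : ∀ p', IsPDF p' → mirrorObjective q a z p v ≤ mirrorObjective q a z p' v) :
    p =ᵐ[volume] expTilt a f v := by
  have ht := isPDF_expTilt ha hf hfL hv
  obtain ⟨h1, h2⟩ := expTilt_hasFiniteKL ha hf hfL hv
  have hlin : ∀ g : X → ℝ, a * ∫ x, -Real.log (q z x) * g x = -(a * ∫ x, g x * f x) := fun g => by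
    rw [← mul_neg, ← integral_neg]
    simp_rw [hfq, mul_comm (g _), neg_mul]
  have hval : ∀ g, IsPDF g → HasFiniteKL g v →
      mirrorObjective q a z g v = ((-(a * ∫ x, g x * f x) + klReal g v : ℝ) : EReal) := by
    intro g hg hgf
    rw [mirrorObjective, hlin, hgf.kl_eq hg hv, EReal.coe_ennreal_ofReal,
      max_eq_left (hgf.klReal_nonneg hg hv), EReal.coe_add]
  have hle := hmin _ ht
  rw [hval _ ht h1] at hle
  have hpv : HasFiniteKL p v := by
    rw [← kl_ne_top_iff hp hv]
    intro htop
    rw [mirrorObjective, htop, EReal.coe_ennreal_top, EReal.coe_add_top, top_le_iff] at hle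
    exact EReal.coe_ne_top _ hle
  rw [hval _ hp hpv, EReal.coe_le_coe_iff] at hle
  obtain ⟨h3, h4⟩ := klReal_expTilt ha hf hfL hv hp hpv
  have h0 : klReal p (expTilt a f v) ≤ 0 := by linarith
  have hkl := h3.kl_eq hp ht
  rw [ENNReal.ofReal_of_nonpos h0] at hkl
  have := hp.isProbabilityMeasure
  have := ht.isProbabilityMeasure
  exact ae_eq_of_densityMeasure_eq hp ht (InformationTheory.klDiv_eq_zero_iff.1 hkl)

end MirrorStep

/-! ### Total variation -/

section TotalVariation

variable {X : Type*} [MeasureSpace X] {p g h : X → ℝ}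

lemma integral_abs_sub_triangle (hp : IsPDF p) (hg : IsPDF g) (hh : IsPDF h) :
    ∫ x, |p x - h x| ≤ (∫ x, |p x - g x|) + ∫ x, |g x - h x| := by
  refine le_of_le_of_eq ?_ (integral_add (hp.integrable.sub hg.integrable).abs
    (hg.integrable.sub hh.integrable).abs)
  exact integral_mono (hp.integrable.sub hh.integrable).abs
    ((hp.integrable.sub hg.integrable).abs.add (hg.integrable.sub hh.integrable).abs)
    fun x => abs_sub_le _ _ _

/-- The total variation distance is half of the `L¹` distance. -/
lemma two_mul_tvDist (hp : IsPDF p) (hg : IsPDF g) : 2 * tvDist p g = ∫ x, |p x - g x| := by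
  have hi : Integrable fun x => p x - g x := hp.integrable.sub hg.integrable
  have h0 : ∫ x, (p x - g x) = 0 := by
    rw [integral_sub hp.integrable hg.integrable, hp.integral_eq_one, hg.integral_eq_one, sub_self]
  have hB : ∀ B, MeasurableSet B →
      (∫ x in B, p x) - ∫ x in B, g x = ∫ x in B, (p x - g x) := fun B _ =>
    (integral_sub hp.integrable.integrableOn hg.integrable.integrableOn).symm
  have hle : ∀ B : {B : Set X // MeasurableSet B},
      |(∫ x in B.1, p x) - ∫ x in B.1, g x| ≤ (∫ x, |p x - g x|) / 2 := by
    rintro ⟨B, hBm⟩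
    simp only [hB B hBm]
    have h1 := integral_add_compl hBm hi
    have h2 := integral_add_compl hBm hi.abs
    have h3 : |∫ x in B, (p x - g x)| ≤ ∫ x in B, |p x - g x| := abs_integral_le_integral_abs
    have h4 : |∫ x in Bᶜ, (p x - g x)| ≤ ∫ x in Bᶜ, |p x - g x| := abs_integral_le_integral_abs
    have h5 : ∫ x in Bᶜ, (p x - g x) = -∫ x in B, (p x - g x) := by linarith
    rw [h5, abs_neg] at h4
    linarith
  refine le_antisymm ?_ ?_
  · have := ciSup_le hle
    rw [tvDist]
    linarith
  · have hBm : MeasurableSet {x | g x ≤ p x} := measurableSet_le hg.measurable hp.measurable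
    have h1 := le_ciSup (f := fun B : {B : Set X // MeasurableSet B} =>
      |(∫ x in B.1, p x) - ∫ x in B.1, g x|) ⟨_, by rintro _ ⟨B, rfl⟩; exact hle B⟩ ⟨_, hBm⟩
    simp only [hB _ hBm] at h1
    have h2 := integral_add_compl hBm hi
    have h3 := integral_add_compl hBm hi.abs
    have h4 : ∫ x in {x | g x ≤ p x}, |p x - g x| = ∫ x in {x | g x ≤ p x}, (p x - g x) :=
      setIntegral_congr_fun hBm fun x hx => abs_of_nonneg (sub_nonneg.2 hx)
    have h5 : ∫ x in {x | g x ≤ p x}ᶜ, |p x - g x| =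
        -∫ x in {x | g x ≤ p x}ᶜ, (p x - g x) := by
      rw [← integral_neg]
      exact setIntegral_congr_fun hBm.compl fun x hx =>
        abs_of_neg (sub_neg.2 (not_le.1 hx))
    have h6 := le_abs_self (∫ x in {x | g x ≤ p x}, (p x - g x))
    rw [tvDist]
    linarith

lemma tvDist_congr_ae {p' g' : X → ℝ} (hp : p =ᵐ[volume] p') (hg : g =ᵐ[volume] g') :
    tvDist p g = tvDist p' g' := by
  unfold tvDist
  congr 1
  funext B
  rw [integral_congr_ae (ae_restrict_of_ae hp), integral_congr_ae (ae_restrict_of_ae hg)]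

lemma integral_abs_marginal_sub_le {m : ℕ} {d : Fin m → ℕ} {S T : Finset (Fin m)}
    {p g : VarSpace d T → ℝ} (hST : S ⊆ T) (hp : IsPDF p) (hg : IsPDF g) :
    ∫ x, |marginal S p x - marginal S g x| ≤ ∫ x, |p x - g x| := by
  have hpm := hp.marginal hST
  have hgm := hg.marginal hST
  let s : VarSpace d S → ℝ := fun x => if marginal S g x ≤ marginal S p x then 1 else -1
  have hs : Measurable s := Measurable.ite
    (measurableSet_le hgm.measurable hpm.measurable) measurable_const measurable_const
  have hs1 : ∀ x, |s x| ≤ 1 := fun x => by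
    simp only [s]
    split_ifs <;> simp
  have hsR : Measurable fun x => s (restrictVars hST x) := hs.comp (measurable_restrictVars hST)
  have i1 := integrable_mul_of_bounded hpm.integrable hs hs1
  have i2 := integrable_mul_of_bounded hgm.integrable hs hs1
  have i3 := integrable_mul_of_bounded hp.integrable hsR fun x => hs1 _
  have i4 := integrable_mul_of_bounded hg.integrable hsR fun x => hs1 _
  calc ∫ x, |marginal S p x - marginal S g x|
      = ∫ x, (marginal S p x * s x - marginal S g x * s x) := by
        refine integral_congr_ae (ae_of_all _ fun x => ?_)
        simp only [s]
        split_ifs with hx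
        · rw [abs_of_nonneg (sub_nonneg.2 hx)]
          ring
        · rw [abs_of_neg (sub_neg.2 (not_le.1 hx))]
          ring
    _ = ∫ x, (p x * s (restrictVars hST x) - g x * s (restrictVars hST x)) := by
        rw [integral_sub i1 i2, integral_sub i3 i4, hp.integral_marginal_mul hST hs,
          hg.integral_marginal_mul hST hs]
    _ ≤ ∫ x, |p x - g x| := by
        refine integral_mono (i3.sub i4) (hp.integrable.sub hg.integrable).abs fun x => ?_
        simp only [← sub_mul]
        refine (le_abs_self _).trans ?_
        rw [abs_mul]
        exact mul_le_of_le_one_right (abs_nonneg _) (hs1 _)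

lemma abs_integral_mul_sub_le {f : X → ℝ} {L : ℝ} (hp : IsPDF p) (hg : IsPDF g) (hf : Measurable f)
    (hfL : ∀ x, |f x| ≤ L) :
    |(∫ x, p x * f x) - ∫ x, g x * f x| ≤ L * ∫ x, |p x - g x| := by
  have i1 := integrable_mul_of_bounded hp.integrable hf hfL
  have i2 := integrable_mul_of_bounded hg.integrable hf hfL
  rw [← integral_sub i1 i2, ← integral_const_mul]
  refine abs_integral_le_integral_abs.trans (integral_mono (i1.sub i2).abs
    ((hp.integrable.sub hg.integrable).abs.const_mul L) fun x => ?_)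
  simp only [← sub_mul, abs_mul]
  rw [mul_comm]
  exact mul_le_mul_of_nonneg_right (hfL x) (abs_nonneg _)

end TotalVariation

/-! ### Real sequences -/

section Sequences

/-- A perturbed contraction with square summable perturbations `K a t` has square summable errors,
so that the errors are summable against `a`. -/
lemma summable_mul_of_contraction {a u : ℕ → ℝ} {σ K : ℝ} (hσ0 : 0 ≤ σ) (hσ1 : σ < 1)
    (ha0 : ∀ t, 0 ≤ a t) (ha : Summable fun t => a t ^ 2) (hu0 : ∀ t, 0 ≤ u t)
    (hu : ∀ t, u (t + 1) ≤ σ * u t + K * a t) : Summable fun t => a t * u t := by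
  have hs : 0 < 1 - σ := by linarith
  set C := K ^ 2 / (1 - σ) with hC
  -- convexity of the square, with weights `σ` and `1 - σ`
  have hsq : ∀ t, u (t + 1) ^ 2 ≤ σ * u t ^ 2 + C * a t ^ 2 := by
    intro t
    have h1 : u (t + 1) ^ 2 ≤ (σ * u t + K * a t) ^ 2 := pow_le_pow_left₀ (hu0 _) (hu t) 2
    have h2 : (σ * u t + K * a t) ^ 2 ≤ σ * u t ^ 2 + C * a t ^ 2 := by
      have h3 : σ * u t ^ 2 + C * a t ^ 2 - (σ * u t + K * a t) ^ 2 =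
          σ / (1 - σ) * ((1 - σ) * u t - K * a t) ^ 2 := by
        rw [hC]
        field_simp
        ring
      have : 0 ≤ σ / (1 - σ) * ((1 - σ) * u t - K * a t) ^ 2 := by positivity
      linarith
    linarith
  have hC0 : 0 ≤ C := by positivity
  have husq : Summable fun t => u t ^ 2 := by
    refine summable_of_sum_range_le (c := (u 0 ^ 2 + C * ∑' t, a t ^ 2) / (1 - σ))
      (fun t => sq_nonneg _) fun N => ?_
    rw [le_div_iff₀ hs]
    have h1 : ∑ t ∈ Finset.range (N + 1), u t ^ 2 ≤
        u 0 ^ 2 + (σ * ∑ t ∈ Finset.range N, u t ^ 2 + C * ∑ t ∈ Finset.range N, a t ^ 2) := by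
      rw [Finset.sum_range_succ', add_comm, Finset.mul_sum, Finset.mul_sum,
        ← Finset.sum_add_distrib]
      gcongr with t _
      exact hsq t
    rw [Finset.sum_range_succ] at h1
    have h2 : C * ∑ t ∈ Finset.range N, a t ^ 2 ≤ C * ∑' t, a t ^ 2 :=
      mul_le_mul_of_nonneg_left (ha.sum_le_tsum _ fun t _ => sq_nonneg _) hC0
    nlinarith [sq_nonneg (u N)]
  refine Summable.of_nonneg_of_le (fun t => mul_nonneg (ha0 t) (hu0 t)) (fun t => ?_)
    (ha.add husq)
  nlinarith [sq_nonneg (a t - u t), sq_nonneg (a t), sq_nonneg (u t)]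

/-- A nonnegative sequence whose increments are bounded by the terms of a convergent series
converges. -/
lemma exists_tendsto_of_le_add {V c : ℕ → ℝ} {s : ℝ} (hV0 : ∀ t, 0 ≤ V t)
    (hV : ∀ t, V (t + 1) ≤ V t + c t)
    (hc : Tendsto (fun N => ∑ t ∈ Finset.range N, c t) atTop (𝓝 s)) :
    ∃ D, Tendsto V atTop (𝓝 D) := by
  set W : ℕ → ℝ := fun t => V t - ∑ k ∈ Finset.range t, c k with hW
  have hanti : Antitone W := antitone_nat_of_succ_le fun t => by
    simp only [hW, Finset.sum_range_succ]
    linarith [hV t]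
  obtain ⟨B, hB⟩ := hc.bddAbove_range
  have hbdd : BddBelow (Set.range W) := by
    refine ⟨-B, ?_⟩
    rintro _ ⟨t, rfl⟩
    have := hB ⟨t, rfl⟩
    simp only [hW]
    linarith [hV0 t]
  refine ⟨_, ((tendsto_atTop_ciInf hanti hbdd).add hc).congr fun t => ?_⟩
  simp [hW]

end Sequences

/-! ### Series of centered functions of fresh measurements -/

section Martingale

variable {Ω E : Type*} {mΩ : MeasurableSpace Ω} [MeasurableSpace E] {P : Measure Ω}
  [IsProbabilityMeasure P]

lemma integral_comp_eq_zero_of_indepFun {Ω' : Type*} [MeasurableSpace Ω'] {X : Ω → Ω'} {Y : Ω → E}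
    (hX : Measurable X) (hY : Measurable Y) (hXY : IndepFun X Y P) {ψ : Ω' × E → ℝ}
    (hψ : Measurable ψ) {C : ℝ} (hC : ∀ w, |ψ w| ≤ C)
    (h0 : ∀ x, ∫ e, ψ (x, e) ∂(P.map Y) = 0) : ∫ ω, ψ (X ω, Y ω) ∂P = 0 := by
  have h1 := (indepFun_iff_map_prod_eq_prod_map_map hX.aemeasurable hY.aemeasurable).1 hXY
  have := Measure.isProbabilityMeasure_map (μ := P) hX.aemeasurable
  have := Measure.isProbabilityMeasure_map (μ := P) hY.aemeasurable
  have h2 := integral_map (μ := P) (hX.prodMk hY).aemeasurable hψ.aestronglyMeasurable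
  rw [← h2, h1, integral_prod]
  · simp [h0]
  · exact Integrable.of_bound hψ.aestronglyMeasurable C (ae_of_all _ hC)

/-- The variant of `integral_comp_eq_zero_of_indepFun` in which `ψ` depends on the outcome itself,
but only through the information in the σ-algebra `𝓜`. -/
lemma integral_comp_eq_zero_of_indep {Ω E : Type*} {𝓜 mΩ : MeasurableSpace Ω} [MeasurableSpace E]
    {P : Measure Ω} [IsProbabilityMeasure P] (h𝓜 : 𝓜 ≤ mΩ) {Y : Ω → E}
    (hY : Measurable Y) (hind : Indep 𝓜 (MeasurableSpace.comap Y inferInstance) P)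
    {ψ : Ω × E → ℝ} (hψ : Measurable[𝓜.prod inferInstance] ψ) {C : ℝ} (hC : ∀ w, |ψ w| ≤ C)
    (h0 : ∀ x, ∫ e, ψ (x, e) ∂(P.map Y) = 0) : ∫ ω, ψ (ω, Y ω) ∂P = 0 := by
  refine @integral_comp_eq_zero_of_indepFun Ω E mΩ _ P _ Ω 𝓜 id Y (measurable_id'' h𝓜) hY ?_ ψ hψ
    C hC h0
  refine (IndepFun_iff_Indep (mβ := 𝓜) _ _ _).2 ?_
  rwa [MeasurableSpace.comap_id]

/-- If `y t` is independent of the past `𝓕 t`, and `φ t`, given the past, is bounded and centered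
for the law of `y t`, then the square summably weighted series of the `φ t (y t)` converges: its
partial sums are a martingale bounded in `L²`. -/
lemma ae_exists_tendsto_sum_of_centered {𝓕 : Filtration ℕ mΩ} {y : ℕ → Ω → E}
    (hy : ∀ t, Measurable[𝓕 (t + 1)] (y t))
    (hind : ∀ t, Indep (𝓕 t) (MeasurableSpace.comap (y t) inferInstance) P)
    {φ : ℕ → Ω × E → ℝ} (hφ : ∀ t, Measurable[(𝓕 t).prod inferInstance] (φ t)) {C : ℝ}
    (hC : ∀ t w, |φ t w| ≤ C) (h0 : ∀ t ω, ∫ e, φ t (ω, e) ∂(P.map (y t)) = 0)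
    {α : ℕ → ℝ} (hα : Summable fun t => α t ^ 2) :
    ∀ᵐ ω ∂P, ∃ s, Tendsto (fun N => ∑ t ∈ Finset.range N, α t * φ t (ω, y t ω)) atTop (𝓝 s) := by
  have hym : ∀ t, Measurable (y t) := fun t => (hy t).mono (𝓕.le _) le_rfl
  set ξ : ℕ → Ω → ℝ := fun t ω => φ t (ω, y t ω) with hξ
  have hξm : ∀ t, Measurable[𝓕 (t + 1)] (ξ t) := fun t => by
    exact (hφ t).comp (Measurable.prodMk (measurable_id'' (𝓕.mono t.le_succ)) (hy t))
  set M : ℕ → Ω → ℝ := fun N ω => ∑ t ∈ Finset.range N, α t * ξ t ω with hM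
  have hMm : ∀ N, Measurable[𝓕 N] (M N) := fun N =>
    Finset.measurable_fun_sum _ fun t ht =>
      ((hξm t).mono (𝓕.mono (Finset.mem_range.1 ht)) le_rfl).const_mul _
  have hMm' : ∀ N, Measurable (M N) := fun N => (hMm N).mono (𝓕.le _) le_rfl
  have hξm' : ∀ N, Measurable (ξ N) := fun N => (hξm N).mono (𝓕.le _) le_rfl
  have hMb : ∀ N ω, |M N ω| ≤ ∑ t ∈ Finset.range N, |α t| * C := fun N ω =>
    (Finset.abs_sum_le_sum_abs _ _).trans (Finset.sum_le_sum fun t _ => by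
      rw [abs_mul]
      exact mul_le_mul_of_nonneg_left (hC _ _) (abs_nonneg _))
  have hMi : ∀ N, Integrable (M N) P := fun N =>
    Integrable.of_bound (hMm' N).aestronglyMeasurable _ (ae_of_all _ (hMb N))
  -- a bounded factor known from the past does not destroy centering
  have hcent : ∀ t (g : Ω → ℝ) (B : ℝ), Measurable[𝓕 t] g → (∀ ω, |g ω| ≤ B) →
      ∫ ω, g ω * ξ t ω ∂P = 0 := by
    intro t g B hg hB
    refine integral_comp_eq_zero_of_indep (𝓕.le t) (hym t) (hind t)
      (ψ := fun w => g w.1 * φ t w) (C := B * C) ?_ (fun w => ?_) fun ω => ?_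
    · exact (hg.comp (@measurable_fst _ _ (𝓕 t) _)).mul (hφ t)
    · rw [abs_mul]
      exact mul_le_mul (hB _) (hC _ _) (abs_nonneg _) ((abs_nonneg _).trans (hB w.1))
    · simp only [integral_const_mul, h0, mul_zero]
  have hmart : Martingale M 𝓕 P := by
    refine martingale_of_condExp_sub_eq_zero_nat (fun N => (hMm N).stronglyMeasurable) hMi
      fun t => ?_
    symm
    refine ae_eq_condExp_of_forall_setIntegral_eq (𝓕.le t) ((hMi _).sub (hMi _))
      (fun s _ _ => integrableOn_zero) (fun s hs _ => ?_)
      (@stronglyMeasurable_zero _ _ (𝓕 t) _ _).aestronglyMeasurable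
    have h1 : ∫ ω, s.indicator (fun _ => (1 : ℝ)) ω * ξ t ω ∂P = 0 :=
      hcent t _ 1 (measurable_const.indicator hs) fun ω => by
        by_cases h : ω ∈ s <;> simp [h]
    have h2 : (fun ω => s.indicator (fun _ => (1 : ℝ)) ω * ξ t ω) = s.indicator (ξ t) := by
      funext ω
      by_cases h : ω ∈ s <;> simp [h]
    rw [h2, integral_indicator (𝓕.le t s hs)] at h1
    have h3 : M (t + 1) - M t = fun ω => α t * ξ t ω := by
      funext ω
      simp [hM, Finset.sum_range_succ]
    rw [h3, integral_const_mul, h1]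
    simp
  have hMsq : ∀ N, ∫ ω, M N ω ^ 2 ∂P ≤ ∑ t ∈ Finset.range N, α t ^ 2 * C ^ 2 := by
    intro N
    induction N with
    | zero => simp [hM]
    | succ N ih =>
      have i1 : Integrable (fun ω => M N ω ^ 2) P :=
        Integrable.of_bound ((hMm' N).pow_const 2).aestronglyMeasurable
          ((∑ t ∈ Finset.range N, |α t| * C) ^ 2) (ae_of_all _ fun ω => by
            rw [Real.norm_eq_abs, abs_pow]
            exact pow_le_pow_left₀ (abs_nonneg _) (hMb N ω) 2)
      have i2 : Integrable (fun ω => 2 * α N * (M N ω * ξ N ω)) P :=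
        ((hMi N).mul_bdd (c := C) (hξm' N).aestronglyMeasurable
          (ae_of_all _ fun ω => hC _ _)).const_mul _
      have i3 : Integrable (fun ω => α N ^ 2 * ξ N ω ^ 2) P :=
        (Integrable.of_bound ((hξm' N).pow_const 2).aestronglyMeasurable (C ^ 2)
          (ae_of_all _ fun ω => by
            rw [Real.norm_eq_abs, abs_pow]
            exact pow_le_pow_left₀ (abs_nonneg _) (hC _ _) 2)).const_mul _
      have e : (fun ω => M (N + 1) ω ^ 2) = fun ω =>
          M N ω ^ 2 + 2 * α N * (M N ω * ξ N ω) + α N ^ 2 * ξ N ω ^ 2 := by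
        funext ω
        simp only [hM, Finset.sum_range_succ]
        ring
      have i12 : Integrable (fun ω => M N ω ^ 2 + 2 * α N * (M N ω * ξ N ω)) P := i1.add i2
      rw [e, integral_add i12 i3, integral_add i1 i2, integral_const_mul,
        hcent N (M N) _ (hMm N) (hMb N), integral_const_mul, Finset.sum_range_succ, mul_zero,
        add_zero]
      refine add_le_add ih (mul_le_mul_of_nonneg_left ?_ (sq_nonneg _))
      have hle : ∫ ω, ξ N ω ^ 2 ∂P ≤ ∫ _, C ^ 2 ∂P :=
        integral_mono_of_nonneg (ae_of_all _ fun ω => sq_nonneg _) (integrable_const _)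
          (ae_of_all _ fun ω => by
            simp only [← sq_abs (ξ N ω)]
            exact pow_le_pow_left₀ (abs_nonneg _) (hC _ _) 2)
      simpa using hle
  set R : ℝ := 1 + (∑' t, α t ^ 2) * C ^ 2 with hR
  have hbdd : ∀ N, eLpNorm (M N) 1 P ≤ (R.toNNReal : ℝ≥0∞) := by
    intro N
    rw [eLpNorm_one_eq_lintegral_enorm, ← ofReal_integral_norm_eq_lintegral_enorm (hMi N)]
    refine ENNReal.ofReal_le_ofReal ?_
    have i1 : Integrable (fun ω => M N ω ^ 2) P :=
      Integrable.of_bound ((hMm' N).pow_const 2).aestronglyMeasurable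
        ((∑ t ∈ Finset.range N, |α t| * C) ^ 2) (ae_of_all _ fun ω => by
          rw [Real.norm_eq_abs, abs_pow]
          exact pow_le_pow_left₀ (abs_nonneg _) (hMb N ω) 2)
    calc ∫ ω, ‖M N ω‖ ∂P ≤ ∫ ω, (1 + M N ω ^ 2) ∂P := by
          refine integral_mono (hMi N).norm ((integrable_const _).add i1) fun ω => ?_
          simp only [Real.norm_eq_abs, ← sq_abs (M N ω)]
          nlinarith [sq_nonneg (|M N ω| - 1), abs_nonneg (M N ω)]
      _ = 1 + ∫ ω, M N ω ^ 2 ∂P := by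
          rw [integral_add (integrable_const _) i1]
          simp
      _ ≤ R := by
          rw [hR]
          refine add_le_add le_rfl ((hMsq N).trans ?_)
          rw [← Finset.sum_mul]
          exact mul_le_mul_of_nonneg_right (hα.sum_le_tsum _ fun t _ => sq_nonneg _) (sq_nonneg _)
  filter_upwards [hmart.submartingale.ae_tendsto_limitProcess hbdd] with ω hω
  exact ⟨_, hω⟩

end Martingale

/-! ### The iterates as functions of the measurements -/

section Iterates

variable {n m : ℕ} {d : Fin m → ℕ} {S : Fin n → Finset (Fin m)} {E : Fin n → Type*}

/-- The iterates of the algorithm in closed form, for log-likelihoods `f i` and measurements `z`. -/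
noncomputable def dmsmdIterates (A : Matrix (Fin n) (Fin n) ℝ)
    (f : ∀ i, E i → VarSpace d (S i) → ℝ) (α : ℕ → ℝ) (p₀ : ∀ i, VarSpace d (S i) → ℝ)
    (z : ℕ → ∀ i, E i) : ℕ → ∀ i, VarSpace d (S i) → ℝ
  | 0 => p₀
  | t + 1 => fun i => expTilt (α t) (f i (z t i)) (mixed A (dmsmdIterates A f α p₀ z t) i)

variable {H : Type*} [MeasurableSpace H]

lemma measurable_uncurry_marginal {U T : Finset (Fin m)} {F : H → VarSpace d T → ℝ}
    (hF : Measurable (Function.uncurry F)) :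
    Measurable (Function.uncurry fun h => (marginal U (F h) : VarSpace d U → ℝ)) := by
  have h1 : StronglyMeasurable fun w : (H × VarSpace d U) × VarSpace d (T \ U) =>
      Function.uncurry F (w.1.1, glueVars w.1.2 w.2) := by
    refine (hF.comp ?_).stronglyMeasurable
    exact (measurable_fst.comp measurable_fst).prodMk
      (measurable_glueVars.comp ((measurable_snd.comp measurable_fst).prodMk measurable_snd))
  exact h1.integral_prod_right.measurable

lemma measurable_uncurry_mixed {A : Matrix (Fin n) (Fin n) ℝ}
    {F : H → ∀ i, VarSpace d (S i) → ℝ} (hF : ∀ i, Measurable (Function.uncurry fun h => F h i))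
    (i : Fin n) : Measurable (Function.uncurry fun h => mixed A (F h) i) := by
  have hmap : ∀ j, Measurable fun w : H × VarSpace d (S i) =>
      (w.1, (restrictVars Finset.inter_subset_left w.2 : VarSpace d (S i ∩ S j))) := fun j =>
    measurable_fst.prodMk ((measurable_restrictVars _).comp measurable_snd)
  have hedge : ∀ j, Measurable fun w : H × VarSpace d (S i) => edgeMerge (F w.1) i j w.2 := by
    intro j
    exact ((hF i).div ((measurable_uncurry_marginal (U := S i ∩ S j) (hF i)).comp (hmap j))).mul
      ((measurable_uncurry_marginal (U := S i ∩ S j) (hF j)).comp (hmap j))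
  have hprod : Measurable fun w : H × VarSpace d (S i) =>
      ∏ j, edgeMerge (F w.1) i j w.2 ^ A i j :=
    Finset.measurable_prod _ fun j _ => (hedge j).pow_const _
  exact hprod.div (hprod.stronglyMeasurable.integral_prod_right'.measurable.comp measurable_fst)

lemma measurable_uncurry_expTilt {X : Type*} [MeasureSpace X] [SFinite (volume : Measure X)]
    {a : ℝ} {f v : H → X → ℝ} (hf : Measurable (Function.uncurry f))
    (hv : Measurable (Function.uncurry v)) :
    Measurable (Function.uncurry fun h => expTilt a (f h) (v h)) := by
  have h1 : Measurable fun w : H × X => Real.exp (a * f w.1 w.2) * v w.1 w.2 :=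
    (hf.const_mul a).exp.mul hv
  exact h1.div (h1.stronglyMeasurable.integral_prod_right'.measurable.comp measurable_fst)

/-- The iterates at time `t` depend measurably on the measurements before time `t`. -/
lemma measurable_uncurry_dmsmdIterates [∀ i, MeasurableSpace (E i)] {A : Matrix (Fin n) (Fin n) ℝ}
    {f : ∀ i, E i → VarSpace d (S i) → ℝ} (hf : ∀ i, Measurable (Function.uncurry (f i)))
    {α : ℕ → ℝ} {p₀ : ∀ i, VarSpace d (S i) → ℝ} (hp₀ : ∀ i, Measurable (p₀ i))
    {z : ℕ → ∀ i, H → E i} (t : ℕ) (hz : ∀ s < t, ∀ i, Measurable (z s i)) (i : Fin n) :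
    Measurable (Function.uncurry fun h =>
      dmsmdIterates A f α p₀ (fun s i => z s i h) t i) := by
  induction t generalizing i with
  | zero => exact (hp₀ i).comp measurable_snd
  | succ t ih =>
    refine measurable_uncurry_expTilt (f := fun h => f i (z t i h)) ?_
      (measurable_uncurry_mixed (ih fun s hs => hz s (hs.trans t.lt_succ_self)) i)
    exact (hf i).comp (((hz t t.lt_succ_self i).comp measurable_fst).prodMk measurable_snd)

/-- All iterates are densities of finite divergence from the marginals of `P`. -/
lemma dmsmdIterates_spec {A : Matrix (Fin n) (Fin n) ℝ} (hA0 : ∀ i j, 0 ≤ A i j)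
    (hAs : A.transpose = A) (hA1 : ∀ i, ∑ j, A i j = 1)
    {f : ∀ i, E i → VarSpace d (S i) → ℝ} (hf : ∀ i e, Measurable (f i e)) {L : ℝ}
    (hfL : ∀ i e x, |f i e x| ≤ L) {α : ℕ → ℝ} (hα : ∀ t, 0 ≤ α t)
    {p₀ : ∀ i, VarSpace d (S i) → ℝ} (hp₀ : ∀ i, IsPDF (p₀ i))
    {P : VarSpace d Finset.univ → ℝ} (hP : IsPDF P)
    (hfin : ∀ i, HasFiniteKL (marginal (S i) P) (p₀ i)) (z : ℕ → ∀ i, E i) (t : ℕ) :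
    (∀ i, IsPDF (dmsmdIterates A f α p₀ z t i)) ∧
      ∀ i, HasFiniteKL (marginal (S i) P) (dmsmdIterates A f α p₀ z t i) := by
  induction t with
  | zero => exact ⟨hp₀, hfin⟩
  | succ t ih =>
    obtain ⟨h1, h2, -⟩ := mixed_spec hA0 hAs hA1 hP ih.1 ih.2
    exact ⟨fun i => isPDF_expTilt (hα t) (hf i _) (hfL i _) (h1 i), fun i =>
      (klReal_expTilt (hα t) (hf i _) (hfL i _) (h1 i) (hP.marginal (Finset.subset_univ _))
        (h2 i)).1⟩

end Iterates

/-! ### Convergence along a fixed sequence of measurements -/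

section Pathwise

variable {n m : ℕ} {d : Fin m → ℕ} {S : Fin n → Finset (Fin m)} {E : Fin n → Type*}

lemma exp_two_mul_sub_one_le {a B L : ℝ} (ha : 0 ≤ a) (haB : a ≤ B) (hL : 0 ≤ L) :
    Real.exp (2 * (a * L)) - 1 ≤ 2 * L * Real.exp (2 * (B * L)) * a := by
  have h1 := Real.add_one_le_exp (-(2 * (a * L)))
  have h2 : Real.exp (2 * (a * L)) * Real.exp (-(2 * (a * L))) = 1 := by
    rw [← Real.exp_add, add_neg_cancel, Real.exp_zero]
  have h3 : Real.exp (2 * (a * L)) - 1 ≤ 2 * (a * L) * Real.exp (2 * (a * L)) := by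
    nlinarith [Real.exp_pos (2 * (a * L))]
  have h4 : Real.exp (2 * (a * L)) ≤ Real.exp (2 * (B * L)) :=
    Real.exp_le_exp.2 (by nlinarith)
  have h5 : 2 * (a * L) * Real.exp (2 * (a * L)) ≤ 2 * (a * L) * Real.exp (2 * (B * L)) :=
    mul_le_mul_of_nonneg_left h4 (by positivity)
  linarith

/-- The mixed densities approach the marginals of the consensus densities `pbar` so fast that the
errors are summable against the step sizes. -/
lemma summable_mul_consensusError {A : Matrix (Fin n) (Fin n) ℝ}
    {f : ∀ i, E i → VarSpace d (S i) → ℝ} (hf : ∀ i e, Measurable (f i e)) {L : ℝ} (hL : 0 ≤ L)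
    (hfL : ∀ i e x, |f i e x| ≤ L) {α : ℕ → ℝ} (hα0 : ∀ t, 0 ≤ α t)
    (hα : Summable fun t => α t ^ 2) {p₀ : ∀ i, VarSpace d (S i) → ℝ} {z : ℕ → ∀ i, E i}
    (hpdf : ∀ t i, IsPDF (dmsmdIterates A f α p₀ z t i))
    (hmix : ∀ t i, IsPDF (mixed A (dmsmdIterates A f α p₀ z t) i))
    {pbar : ℕ → VarSpace d Finset.univ → ℝ} (hpbar : ∀ t, IsPDF (pbar t)) {σ c : ℝ}
    (hσ0 : 0 ≤ σ) (hσ1 : σ < 1)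
    (hcontr : ∀ t i, ∫ x, |mixed A (dmsmdIterates A f α p₀ z t) i x - marginal (S i) (pbar t) x| ≤
      σ * ∫ x, |dmsmdIterates A f α p₀ z t i x - marginal (S i) (pbar t) x|)
    (hdrift : ∀ t, ∫ x, |pbar t x - pbar (t + 1) x| ≤ c * α t) :
    Summable fun t => α t *
      ∑ i, ∫ x, |mixed A (dmsmdIterates A f α p₀ z t) i x - marginal (S i) (pbar t) x| := by
  set B := √(∑' t, α t ^ 2)
  have hB : ∀ t, α t ≤ B := fun t =>
    Real.le_sqrt_of_sq_le (hα.le_tsum t fun s _ => sq_nonneg _)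
  refine summable_mul_of_contraction hσ0 hσ1 (K := σ * (n * (2 * L * Real.exp (2 * (B * L)) + c)))
    hα0 hα (fun t => Finset.sum_nonneg fun i _ => integral_nonneg fun x => abs_nonneg _)
    fun t => ?_
  have hbar : ∀ t i, IsPDF (marginal (S i) (pbar t)) := fun t i =>
    (hpbar t).marginal (Finset.subset_univ _)
  have hstep : ∀ i, ∫ x, |mixed A (dmsmdIterates A f α p₀ z (t + 1)) i x -
      marginal (S i) (pbar (t + 1)) x| ≤
      σ * ((∫ x, |mixed A (dmsmdIterates A f α p₀ z t) i x - marginal (S i) (pbar t) x|) +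
        (2 * L * Real.exp (2 * (B * L)) + c) * α t) := by
    intro i
    refine (hcontr (t + 1) i).trans (mul_le_mul_of_nonneg_left ?_ hσ0)
    have h1 := integral_abs_sub_triangle (hpdf (t + 1) i) (hmix t i) (hbar (t + 1) i)
    have h2 := integral_abs_sub_triangle (hmix t i) (hbar t i) (hbar (t + 1) i)
    have h3 := (integral_abs_expTilt_sub_le (hα0 t) (hf i (z t i)) (hfL i _) (hmix t i)).trans
      (exp_two_mul_sub_one_le (hα0 t) (hB t) hL)
    have h4 := (integral_abs_marginal_sub_le (Finset.subset_univ (S i)) (hpbar t)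
      (hpbar (t + 1))).trans (hdrift t)
    have h5 : (∫ x, |dmsmdIterates A f α p₀ z (t + 1) i x -
        mixed A (dmsmdIterates A f α p₀ z t) i x|) ≤ 2 * L * Real.exp (2 * (B * L)) * α t := h3
    linarith
  refine (Finset.sum_le_sum fun i _ => hstep i).trans (le_of_eq ?_)
  rw [← Finset.mul_sum, Finset.sum_add_distrib, Finset.sum_const, Finset.card_univ,
    Fintype.card_fin, nsmul_eq_mul]
  ring

/-- Along a fixed sequence of measurements, the total divergence converges as soon as the
weighted series of the deviations of the log-likelihoods from their means `G` converges. -/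
lemma exists_tendsto_sum_klReal {A : Matrix (Fin n) (Fin n) ℝ} (hA0 : ∀ i j, 0 ≤ A i j)
    (hAs : A.transpose = A) (hA1 : ∀ i, ∑ j, A i j = 1)
    {f : ∀ i, E i → VarSpace d (S i) → ℝ} (hf : ∀ i e, Measurable (f i e)) {L : ℝ} (hL : 0 ≤ L)
    (hfL : ∀ i e x, |f i e x| ≤ L) {α : ℕ → ℝ} (hα0 : ∀ t, 0 ≤ α t)
    (hα : Summable fun t => α t ^ 2) {p₀ : ∀ i, VarSpace d (S i) → ℝ} (hp₀ : ∀ i, IsPDF (p₀ i))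
    {P : VarSpace d Finset.univ → ℝ} (hP : IsPDF P)
    (hfin : ∀ i, HasFiniteKL (marginal (S i) P) (p₀ i)) {z : ℕ → ∀ i, E i}
    {G : ∀ i, (VarSpace d (S i) → ℝ) → ℝ}
    (hG : ∀ i p g, IsPDF p → IsPDF g → G i p - G i g ≤ L * ∫ x, |p x - g x|)
    (hopt : ∀ p : VarSpace d Finset.univ → ℝ, IsPDF p →
      ∑ i, G i (marginal (S i) p) ≤ ∑ i, G i (marginal (S i) P))
    (hnoise : ∀ i, ∃ s, Tendsto (fun N => ∑ t ∈ Finset.range N, α t *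
      (((∫ x, mixed A (dmsmdIterates A f α p₀ z t) i x * f i (z t i) x) -
        ∫ x, marginal (S i) P x * f i (z t i) x) -
        (G i (mixed A (dmsmdIterates A f α p₀ z t) i) - G i (marginal (S i) P)))) atTop (𝓝 s))
    {pbar : ℕ → VarSpace d Finset.univ → ℝ} (hpbar : ∀ t, IsPDF (pbar t)) {σ c : ℝ}
    (hσ0 : 0 ≤ σ) (hσ1 : σ < 1)
    (hcontr : ∀ t i, ∫ x, |mixed A (dmsmdIterates A f α p₀ z t) i x - marginal (S i) (pbar t) x| ≤
      σ * ∫ x, |dmsmdIterates A f α p₀ z t i x - marginal (S i) (pbar t) x|)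
    (hdrift : ∀ t, ∫ x, |pbar t x - pbar (t + 1) x| ≤ c * α t) :
    ∃ D, Tendsto (fun t => ∑ i, klReal (marginal (S i) P)
      (mixed A (dmsmdIterates A f α p₀ z t) i)) atTop (𝓝 D) := by
  have hPi : ∀ i, IsPDF (marginal (S i) P) := fun i => hP.marginal (Finset.subset_univ _)
  have hspec := dmsmdIterates_spec hA0 hAs hA1 hf hfL hα0 hp₀ hP hfin z
  have hmix := fun t => mixed_spec hA0 hAs hA1 hP (hspec t).1 (hspec t).2
  have hu := summable_mul_consensusError hf hL hfL hα0 hα (fun t => (hspec t).1)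
    (fun t => (hmix t).1) hpbar hσ0 hσ1 hcontr hdrift
  set u : ℕ → ℝ := fun t =>
    ∑ i, ∫ x, |mixed A (dmsmdIterates A f α p₀ z t) i x - marginal (S i) (pbar t) x| with hudef
  set ξ : Fin n → ℕ → ℝ := fun i t =>
    ((∫ x, mixed A (dmsmdIterates A f α p₀ z t) i x * f i (z t i) x) -
      ∫ x, marginal (S i) P x * f i (z t i) x) -
      (G i (mixed A (dmsmdIterates A f α p₀ z t) i) - G i (marginal (S i) P)) with hξ
  choose s hs using hnoise
  have hconv : Tendsto (fun N => ∑ t ∈ Finset.range N,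
      ((∑ i, α t * ξ i t) + L * (α t * u t) + n * L ^ 2 / 2 * α t ^ 2)) atTop
      (𝓝 ((∑ i, s i) + L * (∑' t, α t * u t) + n * L ^ 2 / 2 * ∑' t, α t ^ 2)) := by
    have h1 : Tendsto (fun N => ∑ i, ∑ t ∈ Finset.range N, α t * ξ i t) atTop (𝓝 (∑ i, s i)) :=
      tendsto_finsetSum _ fun i _ => hs i
    have h2 := (h1.add (hu.hasSum.tendsto_sum_nat.const_mul L)).add
      (hα.hasSum.tendsto_sum_nat.const_mul (n * L ^ 2 / 2))
    refine h2.congr fun N => ?_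
    rw [Finset.sum_add_distrib, Finset.sum_add_distrib, Finset.mul_sum, Finset.mul_sum,
      Finset.sum_comm]
  refine exists_tendsto_of_le_add
    (fun t => Finset.sum_nonneg fun i _ => ((hmix t).2.1 i).klReal_nonneg (hPi i) ((hmix t).1 i))
    (fun t => ?_) hconv
  have hmirror : ∀ i, klReal (marginal (S i) P) (dmsmdIterates A f α p₀ z (t + 1) i) ≤
      klReal (marginal (S i) P) (mixed A (dmsmdIterates A f α p₀ z t) i) + α t * ξ i t +
        α t * (G i (mixed A (dmsmdIterates A f α p₀ z t) i) - G i (marginal (S i) P)) +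
        α t ^ 2 * L ^ 2 / 2 := by
    intro i
    have h1 := (klReal_expTilt (hα0 t) (hf i (z t i)) (hfL i _) ((hmix t).1 i) (hPi i)
      ((hmix t).2.1 i)).2
    have h2 := log_integral_exp_mul_le (hα0 t) (hf i (z t i)) (hfL i _) ((hmix t).1 i)
    have h3 : klReal (marginal (S i) P) (dmsmdIterates A f α p₀ z (t + 1) i) =
      klReal (marginal (S i) P) (expTilt (α t) (f i (z t i))
        (mixed A (dmsmdIterates A f α p₀ z t) i)) := rfl
    rw [h3, h1]
    simp only [hξ]
    linarith
  have hmean : ∑ i, (G i (mixed A (dmsmdIterates A f α p₀ z t) i) - G i (marginal (S i) P)) ≤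
      L * u t := by
    have h1 := Finset.sum_le_sum fun i (_ : i ∈ Finset.univ) =>
      hG i _ _ ((hmix t).1 i) ((hpbar t).marginal (Finset.subset_univ (S i)))
    rw [← Finset.mul_sum, Finset.sum_sub_distrib] at h1
    rw [Finset.sum_sub_distrib]
    have h2 := hopt _ (hpbar t)
    linarith
  have h4 := mul_le_mul_of_nonneg_left hmean (hα0 t)
  refine ((hmix (t + 1)).2.2.trans (Finset.sum_le_sum fun i _ => hmirror i)).trans ?_
  simp only [Finset.sum_add_distrib, ← Finset.mul_sum, Finset.sum_const, Finset.card_univ,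
    Fintype.card_fin, nsmul_eq_mul] at h4 ⊢
  linarith

end Pathwise

/-! ### Log-likelihoods and the estimation objective -/

section Likelihood

open Classical in
/-- The log-likelihood, extended by zero outside of the measurement set, where the likelihood is
not controlled. -/
noncomputable def truncatedLog {E X : Type*} (Z : Set E) (q : E → X → ℝ) (e : E) (x : X) : ℝ :=
  if e ∈ Z then Real.log (q e x) else 0

variable {E X : Type*} [MeasureSpace E]

lemma measurable_uncurry_truncatedLog [MeasurableSpace X] {Z : Set E} (hZ : MeasurableSet Z)
    {q : E → X → ℝ} (hq : Measurable (Function.uncurry q)) :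
    Measurable (Function.uncurry (truncatedLog Z q)) :=
  Measurable.ite (measurable_fst hZ) hq.log measurable_const

lemma abs_truncatedLog_le {E X : Type*} {Z : Set E} {q : E → X → ℝ} {L : ℝ}
    (hL : ∀ e ∈ Z, ∀ x, |Real.log (q e x)| ≤ L) (e : E) (x : X) :
    |truncatedLog Z q e x| ≤ max L 0 := by
  unfold truncatedLog
  split_ifs with h
  · exact (hL e h x).trans (le_max_left _ _)
  · simp

lemma IsLikelihood.isProbabilityMeasure [MeasurableSpace X] {Z : Set E} {q : E → X → ℝ}
    (hq : IsLikelihood Z q) (x : X) : IsProbabilityMeasure (measurementLaw Z q x) :=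
  ⟨by rw [measurementLaw, withDensity_apply _ MeasurableSet.univ, setLIntegral_univ,
      ← ofReal_integral_eq_lintegral_ofReal (hq.integrable x) (ae_of_all _ fun e => hq.nonneg e x),
      hq.integral_eq_one, ENNReal.ofReal_one]⟩

lemma ae_measurementLaw_mem {Z : Set E} (hZ : MeasurableSet Z) (q : E → X → ℝ) (x : X) :
    ∀ᵐ e ∂(measurementLaw Z q x), e ∈ Z :=
  (withDensity_absolutelyContinuous _ _).ae_le (ae_restrict_mem hZ)

end Likelihood

section MeanValue

/-- The expectation under `μ` of the mean of `f` under the density `p`. -/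
noncomputable def meanValue {E X : Type*} [MeasurableSpace E] [MeasureSpace X] (μ : Measure E)
    (f : E → X → ℝ) (p : X → ℝ) : ℝ :=
  ∫ e, (∫ x, p x * f e x) ∂μ

variable {E X : Type*} [MeasurableSpace E] [MeasureSpace X] {p g : X → ℝ} {f : E → X → ℝ} {L : ℝ}

lemma measurable_integral_mul [SFinite (volume : Measure X)] (hp : Measurable p)
    (hf : Measurable (Function.uncurry f)) : Measurable fun e => ∫ x, p x * f e x :=
  ((hp.comp measurable_snd).mul hf).stronglyMeasurable.integral_prod_right'.measurable

lemma abs_integral_density_mul_le {f : X → ℝ} (hp : IsPDF p) (hfL : ∀ x, |f x| ≤ L) :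
    |∫ x, p x * f x| ≤ L := by
  rw [← Real.norm_eq_abs]
  refine (norm_integral_le_of_norm_le (hp.integrable.mul_const L) (ae_of_all _ fun x => ?_)).trans
    (le_of_eq ?_)
  · rw [norm_mul, Real.norm_of_nonneg (hp.nonneg x)]
    exact mul_le_mul_of_nonneg_left (hfL x) (hp.nonneg x)
  · rw [integral_mul_const, hp.integral_eq_one, one_mul]

lemma integrable_integral_mul [SFinite (volume : Measure X)] {μ : Measure E} [IsFiniteMeasure μ]
    (hp : IsPDF p) (hf : Measurable (Function.uncurry f)) (hfL : ∀ e x, |f e x| ≤ L) :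
    Integrable (fun e => ∫ x, p x * f e x) μ :=
  Integrable.of_bound (measurable_integral_mul hp.measurable hf).aestronglyMeasurable L
    (ae_of_all _ fun e => abs_integral_density_mul_le hp (hfL e))

lemma abs_meanValue_le {μ : Measure E} [IsProbabilityMeasure μ] (hp : IsPDF p)
    (hfL : ∀ e x, |f e x| ≤ L) : |meanValue μ f p| ≤ L := by
  simpa [meanValue] using norm_integral_le_of_norm_le_const (μ := μ)
    (f := fun e => ∫ x, p x * f e x)
    (ae_of_all _ fun e => abs_integral_density_mul_le hp (hfL e))

lemma meanValue_sub_le [SFinite (volume : Measure X)] {μ : Measure E} [IsProbabilityMeasure μ]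
    (hp : IsPDF p) (hg : IsPDF g) (hf : Measurable (Function.uncurry f))
    (hfL : ∀ e x, |f e x| ≤ L) :
    meanValue μ f p - meanValue μ f g ≤ L * ∫ x, |p x - g x| := by
  have hi := integrable_integral_mul (μ := μ) hp hf hfL
  have hi' := integrable_integral_mul (μ := μ) hg hf hfL
  rw [meanValue, meanValue, ← integral_sub hi hi']
  calc ∫ e, ((∫ x, p x * f e x) - ∫ x, g x * f e x) ∂μ ≤ ∫ _, (L * ∫ x, |p x - g x|) ∂μ :=
        integral_mono (hi.sub hi') (integrable_const _) fun e =>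
          (le_abs_self _).trans (abs_integral_mul_sub_le hp hg hf.of_uncurry_left (hfL e))
    _ = _ := by simp

/-- The objective is a sum over the agents of functions of the marginals. -/
lemma objective_eq {n m : ℕ} {d : Fin m → ℕ} {ℓ : Fin n → ℕ} {S : Fin n → Finset (Fin m)}
    {Z : ∀ i, Set (EuclideanSpace ℝ (Fin (ℓ i)))} (hZ : ∀ i, MeasurableSet (Z i))
    {q : ∀ i, EuclideanSpace ℝ (Fin (ℓ i)) → VarSpace d (S i) → ℝ}
    (hq : ∀ i, IsLikelihood (Z i) (q i)) {L : ℝ}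
    (hL : ∀ i, ∀ y ∈ Z i, ∀ x, 0 < q i y x ∧ |Real.log (q i y x)| ≤ L)
    (xstar : VarSpace d Finset.univ) {p : VarSpace d Finset.univ → ℝ} (hp : IsPDF p) :
    objective Z q xstar p = -∑ i, meanValue
      (measurementLaw (Z i) (q i) (restrictVars (Finset.subset_univ (S i)) xstar))
      (truncatedLog (Z i) (q i)) (marginal (S i) p) := by
  have hprob := fun i => (hq i).isProbabilityMeasure
    (restrictVars (Finset.subset_univ (S i)) xstar)
  have hfm := fun i => measurable_uncurry_truncatedLog (hZ i) (hq i).measurable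
  have hfL := fun i => abs_truncatedLog_le fun e he x => (hL i e he x).2
  have hpm : ∀ i, IsPDF (marginal (S i) p) := fun i => hp.marginal (Finset.subset_univ _)
  set μ := fun i => measurementLaw (Z i) (q i) (restrictVars (Finset.subset_univ (S i)) xstar)
    with hμ
  have heval := fun i => measurePreserving_eval μ i
  have hmem : ∀ᵐ z ∂(Measure.pi μ), ∀ i, z i ∈ Z i := ae_all_iff.2 fun i =>
    (heval i).quasiMeasurePreserving.ae (ae_measurementLaw_mem (hZ i) _ _)
  have hinner : (fun z => ∫ x, -Real.log (jointLikelihood q z x) * p x) =ᵐ[Measure.pi μ]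
      fun z => -∑ i, ∫ x, marginal (S i) p x * truncatedLog (Z i) (q i) (z i) x := by
    filter_upwards [hmem] with z hz
    have h1 : ∀ x, -Real.log (jointLikelihood q z x) * p x = -∑ i, p x *
        truncatedLog (Z i) (q i) (z i) (restrictVars (Finset.subset_univ (S i)) x) := fun x => by
      rw [jointLikelihood, Real.log_prod fun i _ => ((hL i _ (hz i) _).1).ne', ← Finset.mul_sum]
      simp only [truncatedLog, hz, if_true]
      ring
    simp_rw [h1]
    have hint : ∀ i, Integrable fun x => p x *
        truncatedLog (Z i) (q i) (z i) (restrictVars (Finset.subset_univ (S i)) x) := fun i =>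
      integrable_mul_of_bounded hp.integrable
        ((hfm i).of_uncurry_left.comp (measurable_restrictVars _)) fun x => hfL i _ _
    rw [integral_neg, integral_finsetSum _ fun i _ => hint i]
    congr 1
    exact Finset.sum_congr rfl fun i _ =>
      (hp.integral_marginal_mul (Finset.subset_univ (S i)) (hfm i).of_uncurry_left).symm
  rw [objective, integral_congr_ae hinner, integral_neg, integral_finsetSum]
  · congr 1
    refine Finset.sum_congr rfl fun i _ => ?_
    have h2 := integral_map (μ := Measure.pi μ) (heval i).measurable.aemeasurable
      (measurable_integral_mul (hpm i).measurable (hfm i)).aestronglyMeasurable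
    rw [(heval i).map_eq] at h2
    exact h2.symm
  · intro i _
    exact (heval i).integrable_comp_of_integrable (integrable_integral_mul (hpm i) (hfm i) (hfL i))

end MeanValue

/-! ### Runs of the algorithm and their noise -/

section Runs

variable {n m : ℕ} {d : Fin m → ℕ} {ℓ : Fin n → ℕ} {S : Fin n → Finset (Fin m)}

/-- Up to null sets, a run of the algorithm is determined by its measurements. -/
lemma IsDMSMDRun.ae_eq_dmsmdIterates {A : Matrix (Fin n) (Fin n) ℝ} (hA0 : ∀ i j, 0 ≤ A i j)
    (hAs : A.transpose = A) (hA1 : ∀ i, ∑ j, A i j = 1)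
    {q : ∀ i, EuclideanSpace ℝ (Fin (ℓ i)) → VarSpace d (S i) → ℝ}
    {f : ∀ i, EuclideanSpace ℝ (Fin (ℓ i)) → VarSpace d (S i) → ℝ}
    (hf : ∀ i e, Measurable (f i e)) {L : ℝ}
    (hfL : ∀ i e x, |f i e x| ≤ L) {α : ℕ → ℝ} (hα0 : ∀ t, 0 ≤ α t)
    {p₀ : ∀ i, VarSpace d (S i) → ℝ} (hp₀ : ∀ i, IsPDF (p₀ i))
    {P : VarSpace d Finset.univ → ℝ} (hP : IsPDF P)
    (hfin : ∀ i, HasFiniteKL (marginal (S i) P) (p₀ i))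
    {z : ℕ → ∀ i, EuclideanSpace ℝ (Fin (ℓ i))}
    (hfq : ∀ t i x, Real.log (q i (z t i) x) = f i (z t i) x)
    {p : ℕ → ∀ i, VarSpace d (S i) → ℝ} (hp : IsDMSMDRun A q α p₀ z p) (t : ℕ) :
    (∀ i, IsPDF (p t i)) ∧ ∀ i, p t i =ᵐ[volume] dmsmdIterates A f α p₀ z t i := by
  have hspec := dmsmdIterates_spec hA0 hAs hA1 hf hfL hα0 hp₀ hP hfin z
  induction t with
  | zero =>
    rw [hp.1]
    exact ⟨hp₀, fun i => EventuallyEq.rfl⟩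
  | succ t ih =>
    refine ⟨fun i => (hp.2 t i).1, fun i => ?_⟩
    have hmix := mixed_spec hA0 hAs hA1 hP (hspec t).1 (hspec t).2
    have hae := mixed_congr_ae (A := A) ih.2 ih.1 (hspec t).1 i
    refine ae_eq_expTilt_of_forall_le (hα0 t) (hf i _) (hfL i _) (hfq t i) (hmix.1 i)
      (hp.2 t i).1 fun p' hp' => ?_
    have h1 := (hp.2 t i).2 p' hp'
    rwa [mirrorObjective, mirrorObjective, kl_congr_ae EventuallyEq.rfl hae,
      kl_congr_ae EventuallyEq.rfl hae] at h1

variable {Ω : Type*} {mΩ : MeasurableSpace Ω} {E : Fin n → Type*} [∀ i, MeasurableSpace (E i)]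

/-- At time `t`, the measurements before time `t` are known. -/
def measurementFiltration {z : ℕ → ∀ i, Ω → E i} (hz : ∀ t i, Measurable (z t i)) :
    Filtration ℕ mΩ where
  seq t := ⨆ k ∈ {k : ℕ × Fin n | k.1 < t}, MeasurableSpace.comap (z k.1 k.2) inferInstance
  mono' _ _ hst := biSup_mono fun _ hk => lt_of_lt_of_le hk hst
  le' _ := iSup₂_le fun k _ => (hz k.1 k.2).comap_le

lemma measurable_measurementFiltration {z : ℕ → ∀ i, Ω → E i} (hz : ∀ t i, Measurable (z t i))
    {s t : ℕ} (hst : s < t) (i : Fin n) :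
    Measurable[measurementFiltration hz t] (z s i) :=
  Measurable.of_comap_le <| le_iSup₂_of_le (f := fun (k : ℕ × Fin n)
    (_ : k ∈ {k : ℕ × Fin n | k.1 < t}) => MeasurableSpace.comap (z k.1 k.2) inferInstance)
    (s, i) hst le_rfl

lemma indep_measurementFiltration {P : Measure Ω} {z : ℕ → ∀ i, Ω → E i}
    (hz : ∀ t i, Measurable (z t i))
    (hind : iIndepFun (β := fun k : ℕ × Fin n => E k.2) (fun k => z k.1 k.2) P)
    (t : ℕ) (i : Fin n) :
    Indep (measurementFiltration hz t) (MeasurableSpace.comap (z t i) inferInstance) P := by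
  have h := indep_iSup_of_disjoint (fun k : ℕ × Fin n => (hz k.1 k.2).comap_le) hind.iIndep
    (S := {k | k.1 < t}) (T := {(t, i)}) (by simp)
  rwa [iSup_singleton] at h

/-- The deviations of the log-likelihoods from their means form a convergent series. -/
lemma ae_exists_tendsto_noise {P : Measure Ω} [IsProbabilityMeasure P] {z : ℕ → ∀ i, Ω → E i}
    (hz : ∀ t i, Measurable (z t i))
    (hind : iIndepFun (β := fun k : ℕ × Fin n => E k.2) (fun k => z k.1 k.2) P)
    {μ : ∀ i, Measure (E i)} (hlaw : ∀ t i, P.map (z t i) = μ i)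
    {A : Matrix (Fin n) (Fin n) ℝ}
    {f : ∀ i, E i → VarSpace d (S i) → ℝ} (hf : ∀ i, Measurable (Function.uncurry (f i))) {L : ℝ}
    (hfL : ∀ i e x, |f i e x| ≤ L) {α : ℕ → ℝ} (hα : Summable fun t => α t ^ 2)
    {p₀ : ∀ i, VarSpace d (S i) → ℝ} (hp₀ : ∀ i, IsPDF (p₀ i))
    (hmix : ∀ (y : ℕ → ∀ i, E i) t i, IsPDF (mixed A (dmsmdIterates A f α p₀ y t) i))
    {g : ∀ i, VarSpace d (S i) → ℝ} (hg : ∀ i, IsPDF (g i)) (i : Fin n) :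
    ∀ᵐ ω ∂P, ∃ s, Tendsto (fun N => ∑ t ∈ Finset.range N, α t *
      (((∫ x, mixed A (dmsmdIterates A f α p₀ (fun s j => z s j ω) t) i x * f i (z t i ω) x) -
        ∫ x, g i x * f i (z t i ω) x) -
        (meanValue (μ i) (f i) (mixed A (dmsmdIterates A f α p₀ (fun s j => z s j ω) t) i) -
          meanValue (μ i) (f i) (g i)))) atTop (𝓝 s) := by
  have hμ : IsProbabilityMeasure (μ i) := by
    rw [← hlaw 0 i]
    exact Measure.isProbabilityMeasure_map (hz 0 i).aemeasurable
  let V : ℕ → Ω → VarSpace d (S i) → ℝ := fun t ω =>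
    mixed A (dmsmdIterates A f α p₀ (fun s j => z s j ω) t) i
  have hVpdf : ∀ t ω, IsPDF (V t ω) := fun t ω => hmix _ t i
  have hVm : ∀ t, Measurable[(measurementFiltration hz t).prod inferInstance]
      (Function.uncurry (V t)) := fun t =>
    @measurable_uncurry_mixed n m d S Ω (measurementFiltration hz t) A _
      (@measurable_uncurry_dmsmdIterates n m d S E Ω (measurementFiltration hz t) _ A f hf α p₀
        (fun i => (hp₀ i).measurable) z t
        fun s hs j => measurable_measurementFiltration hz hs j) i
  -- the mean of the log-likelihood under a density that depends on the past
  have hint : ∀ t, Measurable[(measurementFiltration hz t).prod inferInstance]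
      fun w : Ω × E i => ∫ x, V t w.1 x * f i w.2 x := by
    intro t
    let _ : MeasurableSpace Ω := measurementFiltration hz t
    have h1 : Measurable fun w : (Ω × E i) × VarSpace d (S i) => V t w.1.1 w.2 * f i w.1.2 w.2 :=
      ((hVm t).comp ((measurable_fst.comp measurable_fst).prodMk measurable_snd)).mul
        ((hf i).comp ((measurable_snd.comp measurable_fst).prodMk measurable_snd))
    exact h1.stronglyMeasurable.integral_prod_right'.measurable
  refine ae_exists_tendsto_sum_of_centered (𝓕 := measurementFiltration hz) (y := fun t => z t i)
    (φ := fun t w => ((∫ x, V t w.1 x * f i w.2 x) - ∫ x, g i x * f i w.2 x) -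
      (meanValue (μ i) (f i) (V t w.1) - meanValue (μ i) (f i) (g i))) (C := 4 * L)
    (fun t => measurable_measurementFiltration hz t.lt_succ_self i)
    (fun t => indep_measurementFiltration hz hind t i) (fun t => ?_) (fun t w => ?_)
    (fun t ω => ?_) hα
  · let _ : MeasurableSpace Ω := measurementFiltration hz t
    refine ((hint t).sub ((measurable_integral_mul (hg i).measurable (hf i)).comp
      measurable_snd)).sub (Measurable.sub_const ?_ _)
    exact (hint t).stronglyMeasurable.integral_prod_right'.measurable.comp measurable_fst
  · have h1 := abs_le.1 (abs_integral_density_mul_le (hVpdf t w.1) (hfL i w.2))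
    have h2 := abs_le.1 (abs_integral_density_mul_le (hg i) (hfL i w.2))
    have h3 := abs_le.1 (abs_meanValue_le (μ := μ i) (hVpdf t w.1) (hfL i))
    have h4 := abs_le.1 (abs_meanValue_le (μ := μ i) (hg i) (hfL i))
    rw [abs_le]
    constructor <;> linarith [h1.1, h1.2, h2.1, h2.2, h3.1, h3.2, h4.1, h4.2]
  · have i1 := integrable_integral_mul (μ := μ i) (hVpdf t ω) (hf i) (hfL i)
    have i2 := integrable_integral_mul (μ := μ i) (hg i) (hf i) (hfL i)
    have i12 : Integrable (fun e => (∫ x, V t ω x * f i e x) - ∫ x, g i x * f i e x) (μ i) :=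
      i1.sub i2
    simp only [hlaw]
    rw [integral_sub i12 (integrable_const _), integral_sub i1 i2]
    simp [meanValue]

end Runs

theorem mainTheorem4
    -- `n` agents, `m` variables of dimensions `d v`, measurements of dimensions `ℓ i`
    {n m : ℕ} (d : Fin m → ℕ) (ℓ : Fin n → ℕ)
    -- the variables estimated by each agent cover all variables
    (S : Fin n → Finset (Fin m)) (hcover : ∀ v, ∃ i, v ∈ S i)
    -- measurement sets and likelihoods, true parameter
    (Z : ∀ i, Set (EuclideanSpace ℝ (Fin (ℓ i)))) (hZ : ∀ i, MeasurableSet (Z i))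
    (q : ∀ i, EuclideanSpace ℝ (Fin (ℓ i)) → VarSpace d (S i) → ℝ)
    (hq : ∀ i, IsLikelihood (Z i) (q i))
    (xstar : VarSpace d Finset.univ)
    -- independent measurements, across time and agents, from the true likelihoods
    {Ω : Type*} [MeasurableSpace Ω] (P : Measure Ω) [IsProbabilityMeasure P]
    (z : ℕ → ∀ i, Ω → EuclideanSpace ℝ (Fin (ℓ i)))
    (hz_meas : ∀ t i, Measurable (z t i))
    (hz_law : ∀ t i, P.map (z t i) =
      measurementLaw (Z i) (q i) (restrictVars (Finset.subset_univ (S i)) xstar))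
    (hz_indep : iIndepFun (β := fun k : ℕ × Fin n => EuclideanSpace ℝ (Fin (ℓ k.2)))
      (fun k => z k.1 k.2) P)
    -- connected network with symmetric doubly stochastic adjacency matrix
    (G : SimpleGraph (Fin n)) (A : Matrix (Fin n) (Fin n) ℝ) (hA : IsGraphAdjacency G A)
    -- bounded gradient
    (L : ℝ) (hL : ∀ i, ∀ y ∈ Z i, ∀ x, 0 < q i y x ∧ |Real.log (q i y x)| ≤ L)
    -- Robbins-Monro steps
    (α : ℕ → ℝ) (hα_pos : ∀ t, 0 < α t) (hα_sum : ¬ Summable α)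
    (hα_sq : Summable fun t => α t ^ 2)
    -- positive priors
    (p₀ : ∀ i, VarSpace d (S i) → ℝ) (hp₀ : ∀ i, IsPDF (p₀ i)) (hp₀_pos : ∀ i x, 0 < p₀ i x)
    -- the agents that estimate a given variable induce a connected subgraph
    (hmarg : ∀ v, (G.induce {i | v ∈ S i}).Connected)
    -- the iterates of the algorithm
    (p : Ω → ℕ → ∀ i, VarSpace d (S i) → ℝ)
    (hp : ∀ᵐ ω ∂P, IsDMSMDRun A q α p₀ (fun t i => z t i ω) (p ω))
    -- the conjectured contraction property
    (hconj : ∃ σ ∈ Set.Ioo (0 : ℝ) 1, ∃ c > (1 : ℝ),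
      ∀ᵐ ω ∂P, MarginalContraction A α L σ c (p ω))
    -- an optimal joint density whose marginals have finite divergence from the priors
    (pstar : VarSpace d Finset.univ → ℝ) (hpstar : pstar ∈ optimalPDFs Z q xstar)
    (hfin : ∀ i, kl (marginal (S i) pstar) (p₀ i) ≠ ∞) :
    ∀ᵐ ω ∂P, ∃ D : ℝ≥0, Tendsto
      (fun t => ∑ i, kl (marginal (S i) pstar) (mixed A (p ω t) i)) atTop (𝓝 (D : ℝ≥0∞)) := by
  have hA0 := hA.nonneg
  have hP : IsPDF pstar := hpstar.1
  -- outside of the measurement sets the log-likelihood is set to zero, which is almost surely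
  -- irrelevant and makes it bounded everywhere
  set f := fun i => truncatedLog (Z i) (q i) with hfdef
  have hfm : ∀ i, Measurable (Function.uncurry (f i)) := fun i =>
    measurable_uncurry_truncatedLog (hZ i) (hq i).measurable
  have hf : ∀ i e, Measurable (f i e) := fun i e => (hfm i).of_uncurry_left
  have hfL : ∀ i e x, |f i e x| ≤ max L 0 := fun i =>
    abs_truncatedLog_le fun e he x => (hL i e he x).2
  have hα0 : ∀ t, 0 ≤ α t := fun t => (hα_pos t).le
  have hPi : ∀ i, IsPDF (marginal (S i) pstar) := fun i => hP.marginal (Finset.subset_univ _)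
  have hfin' : ∀ i, HasFiniteKL (marginal (S i) pstar) (p₀ i) := fun i =>
    (kl_ne_top_iff (hPi i) (hp₀ i)).1 (hfin i)
  set μ := fun i => measurementLaw (Z i) (q i) (restrictVars (Finset.subset_univ (S i)) xstar)
    with hμ
  have hprob : ∀ i, IsProbabilityMeasure (μ i) := fun i => (hq i).isProbabilityMeasure _
  have hspec := fun y => dmsmdIterates_spec hA0 hA.symm hA.row_sum hf hfL hα0 hp₀ hP hfin' y
  have hmix := fun y t => mixed_spec hA0 hA.symm hA.row_sum hP (hspec y t).1 (hspec y t).2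
  have hnoise := ae_all_iff.2 fun i => ae_exists_tendsto_noise hz_meas hz_indep (μ := μ) hz_law
    (A := A) hfm hfL hα_sq hp₀ (fun y t => (hmix y t).1) hPi i
  have hmem : ∀ᵐ ω ∂P, ∀ t i, z t i ω ∈ Z i := ae_all_iff.2 fun t => ae_all_iff.2 fun i => by
    have h1 : ∀ᵐ e ∂(P.map (z t i)), e ∈ Z i := by
      rw [hz_law]
      exact ae_measurementLaw_mem (hZ i) _ _
    exact ae_of_ae_map (hz_meas t i).aemeasurable h1
  obtain ⟨σ, hσ, c, hc, hcontr⟩ := hconj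
  filter_upwards [hp, hcontr, hnoise, hmem] with ω hrun hcω hnω hzω
  -- the given run agrees with the closed form iterates, which are jointly measurable
  have hae := hrun.ae_eq_dmsmdIterates hA0 hA.symm hA.row_sum hf hfL hα0 hp₀ hP hfin'
    fun t i x => by simp [hfdef, truncatedLog, hzω t i]
  set y : ℕ → ∀ i, EuclideanSpace ℝ (Fin (ℓ i)) := fun t i => z t i ω with hy
  have hvae : ∀ t i, mixed A (p ω t) i =ᵐ[volume] mixed A (dmsmdIterates A f α p₀ y t) i :=
    fun t i => mixed_congr_ae (hae t).2 (hae t).1 (hspec y t).1 i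
  obtain ⟨pbar, hpbar⟩ := hcω
  have hbar : ∀ t i, IsPDF (marginal (S i) (pbar t)) := fun t i =>
    (hpbar t).1.marginal (Finset.subset_univ _)
  obtain ⟨D, hD⟩ := exists_tendsto_sum_klReal hA0 hA.symm hA.row_sum hf (le_max_right L 0) hfL hα0
    hα_sq hp₀ hP hfin' (z := y) (G := fun i => meanValue (μ i) (f i))
    (fun i _ _ h1 h2 => meanValue_sub_le h1 h2 (hfm i) (hfL i))
    (fun p' hp' => by
      have h1 := hpstar.2 p' hp'
      rw [objective_eq hZ hq hL xstar hP, objective_eq hZ hq hL xstar hp'] at h1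
      exact neg_le_neg_iff.1 h1)
    hnω (fun t => (hpbar t).1) hσ.1.le hσ.2 (c := (c - 1) * max L 0)
    (fun t i => by
      have h1 := (hpbar t).2.1 i
      rw [tvDist_congr_ae (hvae t i) EventuallyEq.rfl,
        tvDist_congr_ae ((hae t).2 i) EventuallyEq.rfl] at h1
      rw [← two_mul_tvDist ((hmix y t).1 i) (hbar t i),
        ← two_mul_tvDist ((hspec y t).1 i) (hbar t i)]
      linarith)
    (fun t => by
      have h1 := (hpbar t).2.2
      rw [← two_mul_tvDist (hpbar t).1 (hpbar (t + 1)).1]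
      have h2 : (c - 1) * α t * L ≤ (c - 1) * α t * max L 0 :=
        mul_le_mul_of_nonneg_left (le_max_left _ _) (mul_nonneg (sub_pos.2 hc).le (hα0 t))
      linarith)
  have h0 : ∀ t i, 0 ≤ klReal (marginal (S i) pstar) (mixed A (dmsmdIterates A f α p₀ y t) i) :=
    fun t i => ((hmix y t).2.1 i).klReal_nonneg (hPi i) ((hmix y t).1 i)
  refine ⟨D.toNNReal, (ENNReal.tendsto_ofReal hD).congr fun t => ?_⟩
  rw [ENNReal.ofReal_sum_of_nonneg fun i _ => h0 t i]
  refine Finset.sum_congr rfl fun i _ => ?_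
  rw [kl_congr_ae EventuallyEq.rfl (hvae t i), ((hmix y t).2.1 i).kl_eq (hPi i) ((hmix y t).1 i)]
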